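/- Let $\alpha,\beta\in\mathbb C$ with $\Re\alpha>-\tfrac12$ and $\alpha\pm\beta\notin\{-1,-2,\dots\}$, and let $V$ be analytic in an annulus containing the unit circle $C$. For $t>0$ put $$f(z)=f(z;t)=(z-e^{t})^{\alpha+\beta}(z-e^{-t})^{\alpha-\beta}z^{-\alpha+\beta}e^{-i\pi(\alpha+\beta)}e^{V(z)},\qquad z\in C,$$ where the powers are defined with arguments in $[0,2\pi)$, and let $$D_n(t)=\det(f_{j-k})_{j,k=0}^{n-1},\qquad f_k=\frac1{2\pi}\int_0^{2\pi}f(e^{i\theta};t)e^{-ik\theta}\,d\theta,\qquad D_0\equiv 1.$$ Let $t>0$ and $n\in\mathbb N=\{0,1,2,\dots\}$, and suppose that the following Riemann–Hilbert problem has a solution $Y(z)=Y(z;n,t)$: (a) $Y:\mathbb C\setminus C\to\mathbb C^{2\times2}$ is analytic; (b) at every $z\in C$, $Y$ has a limit $Y_+(z)$ from inside and a limit $Y_-(z)$ from outside the circle, and $Y_+(z)=Y_-(z)\begin{pmatrix}1&z^{-n}f(z;t)\\0&1\end{pmatrix}$; (c) $Y(z)=(I+O(1/z))\begin{pmatrix}z^n&0\\0&z^{-n}\end{pmatrix}$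 as $z\to\infty$. Then $D_n(t)\neq0$, and, for any continuous branch of $\ln D_n$ near $t$ (such branches exist), $$\frac{d}{dt}\ln D_n(t)=-(\alpha+\beta)e^{t}\Bigl(Y^{-1}\frac{dY}{dz}\Bigr)_{22}(e^{t})+(\alpha-\beta)e^{-t}\Bigl(Y^{-1}\frac{dY}{dz}\Bigr)_{22}(e^{-t}).$$ -/

import Mathlib

open Filter Topology Asymptotics

noncomputable section

namespace ToeplitzRH

/-- The argument of a complex number, taken in `[0, 2π)`. -/
def argZeroTwoPi (z : ℂ) : ℝ :=
  if 0 ≤ z.arg then z.arg else z.arg + 2 * Real.pi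

/-- The branch of the logarithm corresponding to arguments in `[0, 2π)`. -/
def logZeroTwoPi (z : ℂ) : ℂ :=
  (Real.log ‖z‖ : ℂ) + (argZeroTwoPi z : ℂ) * Complex.I

/-- The power `z ^ c` (`z ≠ 0`) defined with arguments in `[0, 2π)`. -/
def powZeroTwoPi (z c : ℂ) : ℂ :=
  Complex.exp (c * logZeroTwoPi z)

/-- The symbol
`f(z;t) = (z - e^t)^(α+β) (z - e^{-t})^(α-β) z^(-α+β) e^{-iπ(α+β)} e^{V(z)}`. -/
def symbol (α β : ℂ) (V : ℂ → ℂ) (t : ℝ) (z : ℂ) : ℂ :=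
  powZeroTwoPi (z - (Real.exp t : ℂ)) (α + β) *
    powZeroTwoPi (z - (Real.exp (-t) : ℂ)) (α - β) *
    powZeroTwoPi z (-α + β) *
    Complex.exp (-(Complex.I * (Real.pi : ℂ) * (α + β))) *
    Complex.exp (V z)

/-- The Fourier coefficient `f_k = (1/2π) ∫₀^{2π} f(e^{iθ}) e^{-ikθ} dθ`. -/
def fourierCoefficient (f : ℂ → ℂ) (k : ℤ) : ℂ :=
  (1 / (2 * (Real.pi : ℂ))) *
    ∫ θ in (0 : ℝ)..(2 * Real.pi),
      f (Complex.exp ((θ : ℂ) * Complex.I)) *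
        Complex.exp (-((k : ℂ) * (θ : ℂ) * Complex.I))

/-- The Toeplitz determinant `D_n(f) = det (f_{j-k})_{j,k=0}^{n-1}`. -/
def toeplitzDet (n : ℕ) (f : ℂ → ℂ) : ℂ :=
  Matrix.det (Matrix.of fun j k : Fin n => fourierCoefficient f ((j : ℤ) - (k : ℤ)))

/-- `Y` solves the Riemann–Hilbert problem of size `n` for the weight `f` on the counterclockwise
oriented unit circle. The `+` side is the left one, i.e. the inside of the circle. -/
structure IsRHSolution (n : ℕ) (f : ℂ → ℂ) (Y : ℂ → Matrix (Fin 2) (Fin 2) ℂ) : Prop where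
  analytic : ∀ i j, DifferentiableOn ℂ (fun z => Y z i j) (Metric.sphere (0 : ℂ) 1)ᶜ
  jump : ∃ Yplus Yminus : ℂ → Matrix (Fin 2) (Fin 2) ℂ, ∀ z ∈ Metric.sphere (0 : ℂ) 1,
    Tendsto Y (𝓝[{w : ℂ | ‖w‖ < 1}] z) (𝓝 (Yplus z)) ∧
    Tendsto Y (𝓝[{w : ℂ | 1 < ‖w‖}] z) (𝓝 (Yminus z)) ∧
    Yplus z = Yminus z * !![1, z ^ (-(n : ℤ)) * f z; 0, 1]
  atInfinity : ∃ E : ℂ → Matrix (Fin 2) (Fin 2) ℂ,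
    (∀ i j, (fun z => E z i j) =O[Bornology.cobounded ℂ] fun z => 1 / z) ∧
    ∀ᶠ z in Bornology.cobounded ℂ,
      Y z = (1 + E z) * !![z ^ (n : ℤ), 0; 0, z ^ (-(n : ℤ))]

/-- The entrywise complex derivative `dY/dz`. -/
def matrixDeriv (Y : ℂ → Matrix (Fin 2) (Fin 2) ℂ) (z : ℂ) : Matrix (Fin 2) (Fin 2) ℂ :=
  Matrix.of fun i j => deriv (fun w => Y w i j) z

/-- `L` is, in a neighbourhood of `t`, a continuous branch of `ln g`. -/
def IsLogBranchAt (L g : ℝ → ℂ) (t : ℝ) : Prop :=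
  ∀ᶠ s in 𝓝 t, ContinuousAt L s ∧ Complex.exp (L s) = g s

end ToeplitzRH

end

/-! ### Plemelj and Liouville across the unit circle -/

noncomputable section

namespace ToeplitzRH

open Metric Bornology

/-! Reversing the rows turns `D_n`, up to a constant sign, into the Hankel determinant of the
functional `Λ p = (2πi)⁻¹ ∮ w p` with `w = z⁻ⁿ f`. The first column of `Y` has no jump, so by
Liouville (`HasBoundaryValues.exists_polynomial`) it consists of polynomials `P`, `Q`. By Plemelj
(`HasBoundaryValues.eq_cauchy`) the second column is given by the Cauchy transforms of `wP` and
`wQ`, plus a constant when `n = 0`. Its decay at infinity is the orthogonality of `P` and `Q`, which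
forces the Hankel matrix `H` to be invertible (`IsOrthogonalPair.det_hankel_ne_zero`).

In `t`, the logarithmic derivative of `f` is a combination of `1/(z - e^t)` and `1/(z - e^{-t})`. By
Jacobi's formula, the logarithmic derivative of `D_n` is therefore the same combination of
contractions of `H⁻¹` with the moments of `w/(ζ - z)`, at `z = e^{±t}`. Such a contraction is the
functional of `w/(ζ - z)` applied to the Christoffel–Darboux polynomial `k = (P(z)Q - Q(z)P)/(X -
z)` (`sum_inv_hankel_mul`).

On the other side, `det Y = 1` makes `(Y⁻¹Y')₂₂(z)` the derivative at `x = z` of `P(z)Y₂₂(x) -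
Q(z)Y₁₂(x)`. This function is a constant plus `x - z` times the Cauchy transform of `wk`, so its
derivative is that same number (`IsRHSolution.inv_mul_deriv`). -/

/-- `g` is holomorphic off the unit circle, with boundary values `gp` from inside and `gm` from
outside. -/
structure HasBoundaryValues (g gp gm : ℂ → ℂ) : Prop where
  diff : DifferentiableOn ℂ g (sphere (0 : ℂ) 1)ᶜ
  inner : ∀ z ∈ sphere (0 : ℂ) 1, Tendsto g (𝓝[{w : ℂ | ‖w‖ < 1}] z) (𝓝 (gp z))
  outer : ∀ z ∈ sphere (0 : ℂ) 1, Tendsto g (𝓝[{w : ℂ | 1 < ‖w‖}] z) (𝓝 (gm z))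

namespace HasBoundaryValues

variable {g gp gm h hp hm : ℂ → ℂ}

lemma mul (hg : HasBoundaryValues g gp gm) (hh : HasBoundaryValues h hp hm) :
    HasBoundaryValues (fun z => g z * h z) (fun z => gp z * hp z) (fun z => gm z * hm z) :=
  ⟨hg.diff.mul hh.diff, fun z hz => (hg.inner z hz).mul (hh.inner z hz),
    fun z hz => (hg.outer z hz).mul (hh.outer z hz)⟩

lemma sub (hg : HasBoundaryValues g gp gm) (hh : HasBoundaryValues h hp hm) :
    HasBoundaryValues (fun z => g z - h z) (fun z => gp z - hp z) (fun z => gm z - hm z) :=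
  ⟨hg.diff.sub hh.diff, fun z hz => (hg.inner z hz).sub (hh.inner z hz),
    fun z hz => (hg.outer z hz).sub (hh.outer z hz)⟩

lemma of_differentiable (hh : Differentiable ℂ h) : HasBoundaryValues h h h :=
  ⟨hh.differentiableOn, fun _ _ => hh.continuous.continuousAt.continuousWithinAt,
    fun _ _ => hh.continuous.continuousAt.continuousWithinAt⟩

end HasBoundaryValues

lemma isOpen_compl_unitSphere : IsOpen (sphere (0 : ℂ) 1)ᶜ := isClosed_sphere.isOpen_compl

lemma tendsto_circleIntegral_cauchy_atTop {g : ℂ → ℂ} (hg : Tendsto g (cobounded ℂ) (𝓝 0)) (z : ℂ) :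
    Tendsto (fun R : ℝ => ∮ ζ in C(0, R), (ζ - z)⁻¹ * g ζ) atTop (𝓝 0) := by
  rw [Metric.tendsto_nhds]
  intro ε hε
  -- For `R ≥ 2‖z‖` the kernel is at most `2/R` on a circle of length `2πR`, so this choice bounds
  -- the integral by `ε/2`.
  have hδ : 0 < ε / (8 * Real.pi) := by positivity
  have h1 := (Metric.tendsto_nhds.1 hg) _ hδ
  rw [← comap_norm_atTop, eventually_comap] at h1
  filter_upwards [h1, eventually_ge_atTop (2 * ‖z‖), eventually_gt_atTop 0] with R hR hRz hR0
  rw [dist_zero_right]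
  calc ‖∮ ζ in C(0, R), (ζ - z)⁻¹ * g ζ‖ ≤ 2 * Real.pi * R * ((2 / R) * (ε / (8 * Real.pi))) := by
        apply circleIntegral.norm_integral_le_of_norm_le_const hR0.le
        intro ζ hζ
        have hζ' : ‖ζ‖ = R := by simpa using hζ
        rw [norm_mul, norm_inv]
        have h2 := hR ζ hζ'
        rw [dist_zero_right] at h2
        have h3 : R / 2 ≤ ‖ζ - z‖ := by
          have := norm_sub_norm_le ζ z
          linarith
        have h4 : ‖ζ - z‖⁻¹ ≤ 2 / R := by
          rw [← inv_div]
          exact inv_anti₀ (by positivity) h3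
        gcongr
    _ = ε / 2 := by
        have := Real.pi_pos
        field_simp
        norm_num
    _ < ε := by linarith

lemma continuousOn_sub_inv {s : Set ℂ} {z : ℂ} (hz : z ∉ s) :
    ContinuousOn (fun ζ : ℂ => (ζ - z)⁻¹) s :=
  (continuousOn_id.sub continuousOn_const).inv₀ fun _ hζ =>
    sub_ne_zero.2 (ne_of_mem_of_not_mem hζ hz)

lemma setOf_norm_lt_eq : {w : ℂ | ‖w‖ < 1} = ball (0 : ℂ) 1 := by ext; simp

lemma setOf_lt_norm_eq : {w : ℂ | 1 < ‖w‖} = (closedBall (0 : ℂ) 1)ᶜ := by ext; simp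

lemma closure_setOf_lt_norm : closure {w : ℂ | 1 < ‖w‖} = (ball (0 : ℂ) 1)ᶜ := by
  rw [setOf_lt_norm_eq, closure_compl, interior_closedBall _ one_ne_zero]

/-- The continuous extension to the closed disc of a function with an inner boundary value. -/
lemma HasBoundaryValues.exists_inner {g gp gm : ℂ → ℂ} (hg : HasBoundaryValues g gp gm) :
    ∃ G : ℂ → ℂ, DiffContOnCl ℂ G (ball 0 1) ∧ (∀ z ∈ ball (0 : ℂ) 1, G z = g z) ∧
      ∀ z ∈ sphere (0 : ℂ) 1, G z = gp z := by
  have hsub : ball (0 : ℂ) 1 ⊆ (sphere (0 : ℂ) 1)ᶜ := fun z hz h => by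
    simp at hz h; linarith
  have hcl := closure_ball (0 : ℂ) (one_ne_zero (α := ℝ))
  have hE : ∀ z ∈ ball (0 : ℂ) 1, extendFrom (ball 0 1) g z = g z :=
    extendFrom_extends (hg.diff.continuousOn.mono hsub)
  have hin := hg.inner
  rw [setOf_norm_lt_eq] at hin
  refine ⟨extendFrom (ball 0 1) g, ⟨(hg.diff.mono hsub).congr hE, ?_⟩, hE, ?_⟩
  · apply continuousOn_extendFrom subset_rfl
    intro z hz
    rw [hcl] at hz
    rcases (mem_closedBall.1 hz).lt_or_eq with h | h
    · exact ⟨_, (hg.diff.continuousOn.mono hsub) z h⟩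
    · exact ⟨_, hin z h⟩
  · intro z hz
    exact extendFrom_eq (hcl ▸ sphere_subset_closedBall hz) (hin z hz)

/-- The continuous extension to the closed exterior of a function with an outer boundary value. -/
lemma HasBoundaryValues.exists_outer {g gp gm : ℂ → ℂ} (hg : HasBoundaryValues g gp gm) :
    ∃ G : ℂ → ℂ, DifferentiableOn ℂ G (closedBall 0 1)ᶜ ∧ ContinuousOn G (ball 0 1)ᶜ ∧
      (∀ z ∈ (closedBall (0 : ℂ) 1)ᶜ, G z = g z) ∧ ∀ z ∈ sphere (0 : ℂ) 1, G z = gm z := by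
  have hsub : (closedBall (0 : ℂ) 1)ᶜ ⊆ (sphere (0 : ℂ) 1)ᶜ :=
    Set.compl_subset_compl.2 sphere_subset_closedBall
  have hcl := closure_setOf_lt_norm
  have hin := hg.outer
  rw [setOf_lt_norm_eq] at hin hcl
  have hE : ∀ z ∈ (closedBall (0 : ℂ) 1)ᶜ, extendFrom (closedBall 0 1)ᶜ g z = g z :=
    extendFrom_extends (hg.diff.continuousOn.mono hsub)
  refine ⟨extendFrom (closedBall 0 1)ᶜ g, (hg.diff.mono hsub).congr hE, ?_, hE, ?_⟩
  · apply continuousOn_extendFrom hcl.ge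
    intro z hz
    have hz' : 1 ≤ dist z 0 := by simpa using hz
    rcases hz'.lt_or_eq with h | h
    · exact ⟨_, (hg.diff.continuousOn.mono hsub) z (by simpa using h)⟩
    · exact ⟨_, hin z h.symm⟩
  · intro z hz
    refine extendFrom_eq ?_ (hin z hz)
    rw [hcl]
    simp at hz ⊢
    exact hz.ge

lemma circleIntegral_sub_inv_of_norm_gt {z : ℂ} (hz : 1 < ‖z‖) :
    (∮ ζ in C(0, 1), (ζ - z)⁻¹) = 0 := by
  have hz' : z ∉ closedBall (0 : ℂ) 1 := by simpa using hz
  apply DiffContOnCl.circleIntegral_eq_zero zero_le_one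
  refine ⟨fun ζ hζ => DifferentiableAt.differentiableWithinAt ?_, ?_⟩
  · have : ζ - z ≠ 0 := sub_ne_zero.2 fun h => hz' (h ▸ ball_subset_closedBall hζ)
    fun_prop (disch := assumption)
  · rw [closure_ball _ one_ne_zero]
    exact continuousOn_sub_inv hz'

/-- **Plemelj formula**: a function holomorphic off the unit circle that vanishes at infinity is the
Cauchy transform of its jump. -/
theorem HasBoundaryValues.eq_cauchy {g gp gm : ℂ → ℂ} (hg : HasBoundaryValues g gp gm)
    (h0 : Tendsto g (cobounded ℂ) (𝓝 0)) {z : ℂ} (hz : z ∉ sphere (0 : ℂ) 1) :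
    (∮ ζ in C(0, 1), (ζ - z)⁻¹ * (gp ζ - gm ζ)) = 2 * Real.pi * Complex.I * g z := by
  obtain ⟨Gi, hGi, hGi1, hGi2⟩ := hg.exists_inner
  obtain ⟨Go, hGod, hGoc, hGo1, hGo2⟩ := hg.exists_outer
  have hsB : sphere (0 : ℂ) 1 ⊆ (ball (0 : ℂ) 1)ᶜ := fun ζ hζ => by simp at hζ ⊢; exact hζ.ge
  have hGic : ContinuousOn Gi (closedBall 0 1) := by
    rw [← closure_ball _ one_ne_zero]; exact hGi.2
  have hcs := continuousOn_sub_inv hz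
  have hi1 : CircleIntegrable (fun ζ => (ζ - z)⁻¹ * Gi ζ) 0 1 :=
    (hcs.mul (hGic.mono sphere_subset_closedBall)).circleIntegrable zero_le_one
  have hi2 : CircleIntegrable (fun ζ => (ζ - z)⁻¹ * Go ζ) 0 1 :=
    (hcs.mul (hGoc.mono hsB)).circleIntegrable zero_le_one
  have hsplit : (∮ ζ in C(0, 1), (ζ - z)⁻¹ * (gp ζ - gm ζ)) =
      (∮ ζ in C(0, 1), (ζ - z)⁻¹ * Gi ζ) - ∮ ζ in C(0, 1), (ζ - z)⁻¹ * Go ζ := by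
    rw [← circleIntegral.integral_sub hi1 hi2]
    refine circleIntegral.integral_congr zero_le_one fun ζ hζ => ?_
    simp only [hGi2 ζ hζ, hGo2 ζ hζ]
    ring
  have hlarge : ∀ R : ℝ, 1 < R → (∮ ζ in C(0, R), (ζ - z)⁻¹ * Go ζ) =
      ∮ ζ in C(0, R), (ζ - z)⁻¹ * g ζ := by
    intro R hR
    refine circleIntegral.integral_congr (by linarith) fun ζ hζ => ?_
    have : ‖ζ‖ = R := by simpa using hζ
    rw [hGo1 ζ (by simpa [this] using hR)]
  have hlim := tendsto_circleIntegral_cauchy_atTop h0 z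
  have hAc : ∀ R : ℝ, closedBall (0 : ℂ) R \ ball 0 1 ⊆ (ball (0 : ℂ) 1)ᶜ := fun R ζ hζ => hζ.2
  have hAo : ∀ R : ℝ, ball (0 : ℂ) R \ closedBall 0 1 ⊆ (closedBall (0 : ℂ) 1)ᶜ :=
    fun R ζ hζ => hζ.2
  have hnhds : ∀ ζ ∈ (closedBall (0 : ℂ) 1)ᶜ, (closedBall (0 : ℂ) 1)ᶜ ∈ 𝓝 ζ :=
    fun ζ hζ => isClosed_closedBall.isOpen_compl.mem_nhds hζ
  have hz1 : ‖z‖ ≠ 1 := by simpa using hz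
  rcases hz1.lt_or_gt with hlt | hgt
  -- For `z` inside, Cauchy's formula evaluates the inner integral, and the outer one can be pushed
  -- to infinity, where it vanishes.
  · have hzb : z ∈ ball (0 : ℂ) 1 := by simpa using hlt
    have e1 : (∮ ζ in C(0, 1), (ζ - z)⁻¹ * Gi ζ) = 2 * Real.pi * Complex.I * g z := by
      have := hGi.circleIntegral_sub_inv_smul hzb
      simpa [hGi1 z hzb] using this
    have e2 : (∮ ζ in C(0, 1), (ζ - z)⁻¹ * Go ζ) = 0 := by
      refine tendsto_nhds_unique (tendsto_const_nhds.congr' ?_) hlim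
      filter_upwards [eventually_gt_atTop 1] with R hR
      rw [← hlarge R hR]
      symm
      refine Complex.circleIntegral_eq_of_differentiable_on_annulus_off_countable zero_lt_one hR.le
        Set.countable_empty ?_ ?_
      · exact ((continuousOn_sub_inv (by simpa using hlt)).mul hGoc).mono (hAc R)
      · intro ζ hζ
        have hζ1 := hAo R hζ.1
        have hne : ζ - z ≠ 0 := sub_ne_zero.2 fun h => by
          subst h
          exact hζ1 (ball_subset_closedBall hzb)
        have := (hGod ζ hζ1).differentiableAt (hnhds ζ hζ1)
        fun_prop (disch := assumption)
    rw [hsplit, e1, e2, sub_zero]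
  · have hzb : z ∈ (closedBall (0 : ℂ) 1)ᶜ := by simpa using hgt
    have e1 : (∮ ζ in C(0, 1), (ζ - z)⁻¹ * Gi ζ) = 0 := by
      apply DiffContOnCl.circleIntegral_eq_zero zero_le_one
      refine ⟨DifferentiableOn.mul (fun ζ hζ => DifferentiableAt.differentiableWithinAt ?_)
        hGi.1, ?_⟩
      · have : ζ - z ≠ 0 := sub_ne_zero.2 fun h => hzb (h ▸ ball_subset_closedBall hζ)
        fun_prop (disch := assumption)
      · rw [closure_ball _ one_ne_zero]
        exact (continuousOn_sub_inv hzb).mul hGic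
    -- For `z` outside, the pole at `z` obstructs moving the contour. The divided difference
    -- `dslope` removes it; the subtracted term contributes `0` on the unit circle and `2πi g(z)` on
    -- large circles.
    have hslope : ∀ ζ, ζ ≠ z → dslope Go z ζ = (ζ - z)⁻¹ * Go ζ - (ζ - z)⁻¹ * g z := by
      intro ζ hζ
      rw [dslope_of_ne _ hζ, slope_def_field, hGo1 z hzb]
      ring
    have hgz : ∀ R : ℝ, (∀ ζ ∈ sphere (0 : ℂ) R, ζ ≠ z) → 1 ≤ R →
        (∮ ζ in C(0, R), dslope Go z ζ) =
        (∮ ζ in C(0, R), (ζ - z)⁻¹ * Go ζ) - (∮ ζ in C(0, R), (ζ - z)⁻¹) * g z := by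
      intro R hR hR1
      have hc : ContinuousOn (fun ζ => (ζ - z)⁻¹) (sphere (0 : ℂ) R) :=
        continuousOn_sub_inv fun h => hR z h rfl
      have hsR : sphere (0 : ℂ) R ⊆ (ball (0 : ℂ) 1)ᶜ := fun ζ hζ => by
        simp at hζ ⊢; linarith
      have hmul : (∮ ζ in C(0, R), (ζ - z)⁻¹) * g z = ∮ ζ in C(0, R), (ζ - z)⁻¹ * g z := by
        simpa using (circleIntegral.integral_smul_const (fun ζ => (ζ - z)⁻¹) (g z) 0 R).symm
      have i1 : CircleIntegrable (fun ζ => (ζ - z)⁻¹ * Go ζ) 0 R :=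
        (hc.mul (hGoc.mono hsR)).circleIntegrable (by linarith)
      have i2 : CircleIntegrable (fun ζ => (ζ - z)⁻¹ * g z) 0 R :=
        (hc.mul continuousOn_const).circleIntegrable (by linarith)
      rw [hmul, ← circleIntegral.integral_sub i1 i2]
      exact circleIntegral.integral_congr (by linarith) fun ζ hζ => hslope ζ (hR ζ hζ)
    have e2 : (∮ ζ in C(0, 1), (ζ - z)⁻¹ * Go ζ) = 0 - 2 * Real.pi * Complex.I * g z := by
      refine tendsto_nhds_unique (tendsto_const_nhds.congr' ?_) (hlim.sub_const _)
      filter_upwards [eventually_gt_atTop ‖z‖] with R hR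
      have hR1 : 1 < R := hgt.trans hR
      have hann : (∮ ζ in C(0, R), dslope Go z ζ) = ∮ ζ in C(0, 1), dslope Go z ζ := by
        have hd : DifferentiableOn ℂ (dslope Go z) (closedBall 0 1)ᶜ :=
          (Complex.differentiableOn_dslope (hnhds z hzb)).2 hGod
        refine Complex.circleIntegral_eq_of_differentiable_on_annulus_off_countable zero_lt_one
          hR1.le Set.countable_empty ?_ ?_
        · refine ContinuousOn.mono ?_ (hAc R)
          refine (continuousOn_dslope ?_).2
            ⟨hGoc, (hGod z hzb).differentiableAt (hnhds z hzb)⟩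
          exact mem_of_superset (hnhds z hzb) (Set.compl_subset_compl.2 ball_subset_closedBall)
        · intro ζ hζ
          exact (hd ζ (hAo R hζ.1)).differentiableAt (hnhds ζ (hAo R hζ.1))
      rw [hgz R (by rintro ζ hζ rfl; simp at hζ; linarith) hR1.le,
        hgz 1 (by rintro ζ hζ rfl; exact hz hζ) le_rfl, circleIntegral_sub_inv_of_norm_gt hgt,
        circleIntegral.integral_sub_inv_of_mem_ball (by simpa using hR), hlarge R hR1] at hann
      linear_combination -hann
    rw [hsplit, e1, e2]
    ring

/-- A function without jump across the circle that vanishes at infinity is zero. -/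
lemma HasBoundaryValues.eq_zero {g gp : ℂ → ℂ} (hg : HasBoundaryValues g gp gp)
    (h0 : Tendsto g (cobounded ℂ) (𝓝 0)) {z : ℂ} (hz : z ∉ sphere (0 : ℂ) 1) : g z = 0 := by
  have := hg.eq_cauchy h0 hz
  simpa [circleIntegral, Real.pi_ne_zero] using this

lemma HasBoundaryValues.congr {g gp gm hp hm : ℂ → ℂ} (hg : HasBoundaryValues g gp gm)
    (h1 : ∀ z ∈ sphere (0 : ℂ) 1, gp z = hp z) (h2 : ∀ z ∈ sphere (0 : ℂ) 1, gm z = hm z) :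
    HasBoundaryValues g hp hm :=
  ⟨hg.diff, fun z hz => h1 z hz ▸ hg.inner z hz, fun z hz => h2 z hz ▸ hg.outer z hz⟩

/-- The induction step for Liouville: passing to `(g(z) - g(0))/z` creates no jump and lowers the
growth at infinity by one power. -/
lemma HasBoundaryValues.dslope_zero {g gp : ℂ → ℂ} (hg : HasBoundaryValues g gp gp) :
    HasBoundaryValues (dslope g 0) (fun z => z⁻¹ * (gp z - g 0)) (fun z => z⁻¹ * (gp z - g 0)) := by
  have key : ∀ z ∈ sphere (0 : ℂ) 1, ∀ s : Set ℂ, Tendsto g (𝓝[s] z) (𝓝 (gp z)) →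
      Tendsto (dslope g 0) (𝓝[s] z) (𝓝 (z⁻¹ * (gp z - g 0))) := by
    intro z hz s h
    have hz0 : z ≠ 0 := by rintro rfl; simp at hz
    have h1 : Tendsto (fun w : ℂ => w⁻¹) (𝓝[s] z) (𝓝 z⁻¹) :=
      ((continuousAt_id.inv₀ hz0).tendsto).mono_left nhdsWithin_le_nhds
    refine (h1.mul (h.sub_const (g 0))).congr' ?_
    filter_upwards [mem_nhdsWithin_of_mem_nhds (isOpen_ne.mem_nhds hz0)] with w hw
    rw [dslope_of_ne _ hw, slope_def_field, sub_zero, div_eq_inv_mul]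
  refine ⟨(Complex.differentiableOn_dslope (isOpen_compl_unitSphere.mem_nhds (by simp))).2 hg.diff,
    fun z hz => key z hz _ (hg.inner z hz), fun z hz => key z hz _ (hg.outer z hz)⟩

/-- **Liouville's theorem** for functions of polynomial growth without jump across the circle. -/
lemma HasBoundaryValues.exists_polynomial (m : ℕ) : ∀ {g gp : ℂ → ℂ},
    HasBoundaryValues g gp gp → g =o[cobounded ℂ] (fun z => z ^ m) →
    ∃ p : Polynomial ℂ, p.degree < m ∧ ∀ z ∉ sphere (0 : ℂ) 1, g z = p.eval z := by
  induction m with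
  | zero =>
    intro g gp hg ho
    refine ⟨0, by simp, fun z hz => ?_⟩
    simp only [pow_zero] at ho
    simpa using hg.eq_zero ((isLittleO_one_iff ℂ).1 ho) hz
  | succ m ih =>
    intro g gp hg ho
    have hne : ∀ᶠ z : ℂ in cobounded ℂ, z ≠ 0 := by
      have := tendsto_norm_cobounded_atTop (E := ℂ)
      filter_upwards [this.eventually_gt_atTop 0] with z hz
      exact norm_pos_iff.1 hz
    have hc : (fun _ : ℂ => g 0) =o[cobounded ℂ] fun z : ℂ => z ^ (m + 1) := by
      rw [isLittleO_const_left]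
      right
      have h1 : Tendsto (fun x : ℝ => x ^ (m + 1)) atTop atTop := tendsto_pow_atTop m.succ_ne_zero
      refine (h1.comp (tendsto_norm_cobounded_atTop (E := ℂ))).congr fun z => ?_
      simp
    have ho' : dslope g 0 =o[cobounded ℂ] fun z => z ^ m := by
      have h1 : (fun z : ℂ => z⁻¹ * (g z - g 0)) =o[cobounded ℂ]
          fun z : ℂ => z⁻¹ * z ^ (m + 1) :=
        (isBigO_refl _ _).mul_isLittleO (ho.sub hc)
      refine h1.congr' ?_ ?_
      · filter_upwards [hne] with z hz
        rw [dslope_of_ne _ hz, slope_def_field, sub_zero, div_eq_inv_mul]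
      · filter_upwards [hne] with z hz
        rw [pow_succ']
        field_simp
    obtain ⟨p, hp, hpe⟩ := ih hg.dslope_zero ho'
    refine ⟨p * Polynomial.X + Polynomial.C (g 0), ?_, fun z hz => ?_⟩
    · refine (Polynomial.degree_add_le _ _).trans_lt (max_lt ?_ ?_)
      · rw [Polynomial.degree_mul_X]
        push_cast
        exact WithBot.add_lt_add_right (by simp) hp
      · exact Polynomial.degree_C_le.trans_lt (by exact_mod_cast Nat.succ_pos m)
    · have := sub_smul_dslope g 0 z
      rw [hpe z hz, sub_zero, smul_eq_mul] at this
      simp only [Polynomial.eval_add, Polynomial.eval_mul, Polynomial.eval_X, Polynomial.eval_C]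
      linear_combination -this

end ToeplitzRH

end

/-! ### Orthogonal polynomials and Hankel matrices -/

noncomputable section

namespace ToeplitzRH

open Polynomial

section Hankel

variable {Λ : ℂ[X] →ₗ[ℂ] ℂ} {n : ℕ}

/-- The Hankel matrix of the moments of a linear functional on polynomials. -/
def hankel (Λ : ℂ[X] →ₗ[ℂ] ℂ) (n : ℕ) : Matrix (Fin n) (Fin n) ℂ :=
  Matrix.of fun i j => Λ (X ^ ((i : ℕ) + (j : ℕ)))

lemma map_mul_eq_sum (Λ : ℂ[X] →ₗ[ℂ] ℂ) (q : ℂ[X]) {p : ℂ[X]} (hp : p.degree < n) :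
    Λ (q * p) = ∑ i ∈ Finset.range n, p.coeff i * Λ (q * X ^ i) := by
  rcases eq_or_ne p 0 with rfl | h0
  · simp
  conv_lhs => rw [p.as_sum_range' n ((natDegree_lt_iff_degree_lt h0).2 hp)]
  simp only [Finset.mul_sum, map_sum]
  refine Finset.sum_congr rfl fun i _ => ?_
  rw [← C_mul_X_pow_eq_monomial, ← smul_eq_C_mul, mul_smul_comm, map_smul, smul_eq_mul]

lemma map_mul_eq_zero {q p : ℂ[X]} (hq : ∀ i < n, Λ (q * X ^ i) = 0) (hp : p.degree < n) :
    Λ (q * p) = 0 := by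
  rw [map_mul_eq_sum Λ q hp]
  exact Finset.sum_eq_zero fun i hi => by rw [hq i (Finset.mem_range.1 hi), mul_zero]

/-- The orthogonality relations satisfied by the first column of a Riemann–Hilbert solution. -/
structure IsOrthogonalPair (Λ : ℂ[X] →ₗ[ℂ] ℂ) (n : ℕ) (P Q : ℂ[X]) : Prop where
  degP : (P - X ^ n).degree < (n : WithBot ℕ)
  degQ : Q.degree < n
  orthP : ∀ i < n, Λ (P * X ^ i) = 0
  orthQ : ∀ i, i + 1 < n → Λ (Q * X ^ i) = 0
  normQ : ∀ i, i + 1 = n → Λ (Q * X ^ i) = -1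

variable {P Q : ℂ[X]}

lemma IsOrthogonalPair.map_mul_Q (h : IsOrthogonalPair Λ n P Q) {q : ℂ[X]} {m : ℕ}
    (hm : m + 1 = n) (hq : q.degree < n) : Λ (Q * q) = -q.coeff m := by
  rw [map_mul_eq_sum Λ Q hq, ← hm, Finset.sum_range_succ, h.normQ m hm,
    Finset.sum_eq_zero fun i hi => ?_]
  · ring
  · rw [h.orthQ i (by have := Finset.mem_range.1 hi; omega), mul_zero]

/-- The radical of the moment form is stable under multiplication by `X`. -/
lemma IsOrthogonalPair.radical_mul_X (h : IsOrthogonalPair Λ n P Q) {q : ℂ[X]}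
    (hd : q.degree < n) (hq : ∀ i < n, Λ (q * X ^ i) = 0) :
    (q * X).degree < (n : WithBot ℕ) ∧ ∀ i < n, Λ (q * X * X ^ i) = 0 := by
  rcases n with _ | m
  · simp at hd
    simp [hd]
  -- `Λ(Qq)` is minus the top coefficient of `q`, yet it vanishes because `q` is in the radical and
  -- `deg Q < n`.
  have hc : q.coeff m = 0 := by
    have h1 := h.map_mul_Q rfl hd
    rw [mul_comm, map_mul_eq_zero hq h.degQ] at h1
    simpa using h1.symm
  refine ⟨?_, fun i hi => ?_⟩
  · rw [degree_lt_iff_coeff_zero] at hd ⊢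
    intro k hk
    rcases k with _ | k
    · omega
    rw [coeff_mul_X]
    rcases eq_or_ne k m with rfl | hne
    · exact hc
    · exact hd k (by omega)
  · have e : q * X * X ^ i = q * X ^ (i + 1) := by ring
    rw [e]
    rcases Nat.lt_or_ge (i + 1) (m + 1) with hlt | hge
    · exact hq _ hlt
    · have hi' : i + 1 = m + 1 := by omega
      -- Since `P` is monic of degree `n = m + 1`, the one moment not covered by shifting reduces to
      -- orthogonality of `P` and the radical property of `q`.
      have e2 : q * X ^ (m + 1) = P * q - q * (P - X ^ (m + 1)) := by ring
      rw [hi', e2, map_sub, map_mul_eq_zero h.orthP hd, map_mul_eq_zero hq h.degP, sub_zero]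

lemma degree_sum_fin_monomial_lt (c : Fin n → ℂ) :
    (∑ j, C (c j) * X ^ (j : ℕ)).degree < (n : WithBot ℕ) := by
  refine (degree_sum_le _ _).trans_lt ?_
  rw [Finset.sup_lt_iff (by simp)]
  intro j _
  exact (degree_C_mul_X_pow_le _ _).trans_lt (by exact_mod_cast j.2)

lemma coeff_sum_fin_monomial (c : Fin n → ℂ) (i : Fin n) :
    (∑ j, C (c j) * X ^ (j : ℕ)).coeff i = c i := by
  simp only [finsetSum_coeff, coeff_C_mul_X_pow, Fin.val_inj]
  simp

/-- A null vector is a polynomial in the radical. Stability under multiplication by `X` puts `q X ^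
n` among the polynomials of degree below `n`, which leaves only `q = 0`. -/
theorem IsOrthogonalPair.det_hankel_ne_zero (h : IsOrthogonalPair Λ n P Q) :
    (hankel Λ n).det ≠ 0 := by
  intro hdet
  obtain ⟨v, hv0, hv⟩ := Matrix.exists_mulVec_eq_zero_iff.2 hdet
  set q : ℂ[X] := ∑ j, C (v j) * X ^ (j : ℕ) with hq
  have hd : q.degree < n := degree_sum_fin_monomial_lt v
  have hrad : ∀ i < n, Λ (q * X ^ i) = 0 := by
    intro i hi
    have h1 := congrFun hv ⟨i, hi⟩
    simp only [Matrix.mulVec, dotProduct, hankel, Matrix.of_apply, Pi.zero_apply] at h1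
    rw [← h1, hq, Finset.sum_mul, map_sum]
    refine Finset.sum_congr rfl fun j _ => ?_
    rw [mul_assoc, ← smul_eq_C_mul, map_smul, smul_eq_mul, ← pow_add, mul_comm, add_comm i]
  have hall : ∀ m : ℕ, (q * X ^ m).degree < (n : WithBot ℕ) ∧ ∀ i < n, Λ (q * X ^ m * X ^ i) = 0 := by
    intro m
    induction m with
    | zero => simpa using ⟨hd, hrad⟩
    | succ m ih =>
      have := h.radical_mul_X ih.1 ih.2
      rwa [mul_assoc, ← pow_succ] at this
  have hq0 : q = 0 := by
    by_contra hne
    have h1 := (hall n).1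
    rw [degree_mul, degree_X_pow, degree_eq_natDegree hne] at h1
    have h2 : q.natDegree + n < n := by exact_mod_cast h1
    omega
  apply hv0
  funext i
  rw [← coeff_sum_fin_monomial v i, ← hq, hq0]
  simp

/-- **Christoffel–Darboux**: the quotient `k` of `P(z) Q - Q(z) P` by `X - z` reproduces the value
at `z`. -/
lemma IsOrthogonalPair.reproducing (h : IsOrthogonalPair Λ n P Q) {z : ℂ} {k : ℂ[X]}
    (hk : (X - C z) * k = C (P.eval z) * Q - C (Q.eval z) * P) (hk1 : Λ k = 1)
    {q : ℂ[X]} (hq : q.degree < n) : Λ (k * q) = q.eval z := by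
  obtain ⟨r, hr⟩ := X_sub_C_dvd_sub_C_eval (p := q) (a := z)
  -- Dividing by `X - z` gives `deg r ≤ n - 2`. The missing coefficient at `n - 1` is what kills
  -- `Λ(Qr)`.
  have hrd : ∀ m, n ≤ m + 1 → r.coeff m = 0 := by
    have hd : ((X - C z) * r).degree < (n : WithBot ℕ) := by
      rw [← hr]
      rcases Nat.eq_zero_or_pos n with rfl | hn
      · simp at hq
        simp [hq]
      refine (degree_sub_le _ _).trans_lt (max_lt hq ?_)
      exact degree_C_le.trans_lt (by exact_mod_cast hn)
    intro m hm
    rcases eq_or_ne r 0 with rfl | hr0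
    · simp
    rw [degree_mul, degree_X_sub_C, degree_eq_natDegree hr0] at hd
    have h2 : 1 + r.natDegree < n := by exact_mod_cast hd
    exact coeff_eq_zero_of_natDegree_lt (by omega)
  have hrn : r.degree < n := by
    rw [degree_lt_iff_coeff_zero]
    exact fun m hm => hrd m (by omega)
  have hQr : Λ (Q * r) = 0 := by
    rcases n with _ | m
    · have := h.degQ
      simp at this
      simp [this]
    · rw [h.map_mul_Q rfl hrn, hrd m le_rfl, neg_zero]
  -- Write `q = q(z) + (X - z) r`; the factor `X - z` cancels the denominator of `k`, and
  -- orthogonality removes both remaining terms.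
  have e : k * q = C (q.eval z) * k + (C (P.eval z) * (Q * r) - C (Q.eval z) * (P * r)) := by
    have hq' : q = C (q.eval z) + (X - C z) * r := by rw [← hr]; ring
    calc k * q = C (q.eval z) * k + ((X - C z) * k) * r := by
          conv_lhs => rw [hq']
          ring
      _ = _ := by rw [hk]; ring
  rw [e]
  simp only [map_add, map_sub, ← smul_eq_C_mul, map_smul, hk1, hQr,
    map_mul_eq_zero h.orthP hrn]
  simp

lemma IsOrthogonalPair.degree_quotient_lt (h : IsOrthogonalPair Λ n P Q) {z a b : ℂ} {k : ℂ[X]}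
    (hk : (X - C z) * k = C a * Q - C b * P) : k.degree < n := by
  rcases eq_or_ne k 0 with rfl | hk0
  · simp
  have hP : P.degree ≤ n := by
    have e : P = (P - X ^ n) + X ^ n := by ring
    rw [e]
    exact (degree_add_le _ _).trans (max_le h.degP.le (degree_X_pow_le n))
  have h1 : ((X - C z) * k).degree ≤ (n : WithBot ℕ) := by
    rw [hk]
    refine (degree_sub_le _ _).trans (max_le ?_ ?_)
    · rw [← smul_eq_C_mul]; exact (degree_smul_le _ _).trans h.degQ.le
    · rw [← smul_eq_C_mul]; exact (degree_smul_le _ _).trans hP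
  rw [degree_mul, degree_X_sub_C, degree_eq_natDegree hk0] at h1
  have h2 : 1 + k.natDegree ≤ n := by exact_mod_cast h1
  exact (natDegree_lt_iff_degree_lt hk0).1 (by omega)

/-- The contraction of the inverse Hankel matrix with the moments of the functional
`p ↦ Λ (p / (X - z))`, in terms of the reproducing polynomial `k` at `z`. -/
theorem sum_inv_hankel_mul (hdet : (hankel Λ n).det ≠ 0) {z : ℂ} {k : ℂ[X]} (hkd : k.degree < n)
    (hk : ∀ q : ℂ[X], q.degree < n → Λ (k * q) = q.eval z) {Γ : ℂ[X] →ₗ[ℂ] ℂ}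
    (hΓ : ∀ p, Γ ((X - C z) * p) = Λ p) :
    ∑ i : Fin n, ∑ j : Fin n, (hankel Λ n)⁻¹ j i * Γ (X ^ ((i : ℕ) + (j : ℕ))) = Γ k := by
  have hu : IsUnit (hankel Λ n).det := hdet.isUnit
  -- Testing the reproducing property on monomials says that `H` sends the coefficient vector of `k`
  -- to `(z^i)`.
  have hcoef : ∀ j : Fin n, k.coeff j = ∑ i : Fin n, (hankel Λ n)⁻¹ j i * z ^ (i : ℕ) := by
    have hM : (hankel Λ n).mulVec (fun j => k.coeff j) = fun i : Fin n => z ^ (i : ℕ) := by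
      funext i
      have h1 := hk (X ^ (i : ℕ)) (by rw [degree_X_pow]; exact_mod_cast i.2)
      rw [mul_comm, map_mul_eq_sum Λ _ hkd, Finset.sum_range] at h1
      simp only [eval_pow, eval_X] at h1
      rw [← h1]
      simp only [Matrix.mulVec, dotProduct, hankel, Matrix.of_apply]
      exact Finset.sum_congr rfl fun j _ => by rw [pow_add, mul_comm]
    intro j
    have h2 := congrArg (fun v => (hankel Λ n)⁻¹.mulVec v) hM
    simp only [Matrix.mulVec_mulVec, Matrix.nonsing_inv_mul _ hu, Matrix.one_mulVec] at h2
    exact congrFun h2 j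
  have hk' : Γ k = ∑ i : Fin n, ∑ j : Fin n,
      (hankel Λ n)⁻¹ j i * (z ^ (i : ℕ) * Γ (X ^ (j : ℕ))) := by
    have h1 := map_mul_eq_sum Γ 1 hkd
    rw [one_mul, Finset.sum_range] at h1
    rw [h1, Finset.sum_comm]
    refine Finset.sum_congr rfl fun j _ => ?_
    rw [hcoef, Finset.sum_mul, one_mul]
    exact Finset.sum_congr rfl fun i _ => by ring
  rw [hk', ← sub_eq_zero, ← Finset.sum_sub_distrib]
  refine Finset.sum_eq_zero fun i _ => ?_
  rw [← Finset.sum_sub_distrib]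
  -- The factor `X^i - z^i` is divisible by `X - z`, so the discrepancy between the two contractions
  -- involves only rows `a < i` of `H`.
  have hstep : ∀ j : Fin n, Γ (X ^ ((i : ℕ) + (j : ℕ))) - z ^ (i : ℕ) * Γ (X ^ (j : ℕ)) =
      ∑ a ∈ Finset.range i, z ^ ((i : ℕ) - 1 - a) * Λ (X ^ (a + (j : ℕ))) := by
    intro j
    have e : X ^ ((i : ℕ) + (j : ℕ)) - z ^ (i : ℕ) • X ^ (j : ℕ) =
        (X - C z) * ∑ a ∈ Finset.range i, z ^ ((i : ℕ) - 1 - a) • X ^ (a + (j : ℕ)) := by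
      have hg := geom_sum₂_mul (X : ℂ[X]) (C z) i
      calc X ^ ((i : ℕ) + (j : ℕ)) - z ^ (i : ℕ) • X ^ (j : ℕ)
          = (X ^ (i : ℕ) - C z ^ (i : ℕ)) * X ^ (j : ℕ) := by
            rw [smul_eq_C_mul, C_pow, pow_add, sub_mul]
        _ = _ := by
            rw [← hg, mul_comm _ (X - C z), mul_assoc, Finset.sum_mul]
            congr 1
            refine Finset.sum_congr rfl fun a _ => ?_
            rw [smul_eq_C_mul, C_pow, pow_add]
            ring
    rw [← smul_eq_mul, ← map_smul, ← map_sub, e, hΓ, map_sum]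
    exact Finset.sum_congr rfl fun a _ => by rw [map_smul, smul_eq_mul]
  calc ∑ j : Fin n, ((hankel Λ n)⁻¹ j i * Γ (X ^ ((i : ℕ) + (j : ℕ))) -
        (hankel Λ n)⁻¹ j i * (z ^ (i : ℕ) * Γ (X ^ (j : ℕ))))
      = ∑ a ∈ Finset.range i, z ^ ((i : ℕ) - 1 - a) *
          ∑ j : Fin n, Λ (X ^ (a + (j : ℕ))) * (hankel Λ n)⁻¹ j i := by
        simp only [← mul_sub, hstep, Finset.mul_sum]
        rw [Finset.sum_comm]
        exact Finset.sum_congr rfl fun a _ => Finset.sum_congr rfl fun j _ => by ring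
    _ = 0 := by
        refine Finset.sum_eq_zero fun a ha => ?_
        -- Row `a` of `H` against column `i` of `H⁻¹` is an off-diagonal entry of the identity.
        have hai : a < i := Finset.mem_range.1 ha
        have h1 := congrFun (congrFun (Matrix.mul_nonsing_inv _ hu) ⟨a, hai.trans i.2⟩) i
        rw [Matrix.mul_apply, Matrix.one_apply_ne (by
          intro h; have := congrArg Fin.val h; simp at this; omega)] at h1
        simp only [hankel, Matrix.of_apply] at h1 ⊢
        rw [h1, mul_zero]

end Hankel

end ToeplitzRH

end

/-! ### Riemann–Hilbert solutions in terms of orthogonal polynomials -/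

noncomputable section

namespace ToeplitzRH

open Metric Bornology
open Polynomial hiding C X

/-- The linear functional `p ↦ (2πi)⁻¹ ∮ u p` on polynomials. -/
def circleFunctional (u : ℂ → ℂ) (hu : CircleIntegrable u 0 1) : ℂ[X] →ₗ[ℂ] ℂ where
  toFun p := (2 * Real.pi * Complex.I)⁻¹ * ∮ ζ in C(0, 1), u ζ * p.eval ζ
  map_add' p q := by
    have h : ∀ p : ℂ[X], CircleIntegrable (fun ζ => u ζ * p.eval ζ) 0 1 := fun p =>
      hu.mul_continuousOn p.continuous.continuousOn
    rw [← mul_add, ← circleIntegral.integral_add (h p) (h q)]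
    simp only [eval_add, mul_add]
  map_smul' a p := by
    simp only [eval_smul, smul_eq_mul, RingHom.id_apply]
    have h : ∀ ζ, u ζ * (a * p.eval ζ) = a * (u ζ * p.eval ζ) := fun ζ => by ring
    simp only [h, circleIntegral.integral_const_mul]
    ring

lemma circleFunctional_apply {u : ℂ → ℂ} (hu : CircleIntegrable u 0 1) (p : ℂ[X]) :
    circleFunctional u hu p = (2 * Real.pi * Complex.I)⁻¹ * ∮ ζ in C(0, 1), u ζ * p.eval ζ := rfl

lemma circleIntegrable_sub_inv_mul {u : ℂ → ℂ} (hu : CircleIntegrable u 0 1) {z : ℂ}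
    (hz : z ∉ sphere (0 : ℂ) 1) : CircleIntegrable (fun ζ => (ζ - z)⁻¹ * u ζ) 0 1 :=
  hu.continuousOn_mul (by simpa using continuousOn_sub_inv hz)

lemma circleFunctional_X_sub_C_mul {u : ℂ → ℂ} (hu : CircleIntegrable u 0 1) {z : ℂ}
    (hz : z ∉ sphere (0 : ℂ) 1) (p : ℂ[X]) :
    circleFunctional _ (circleIntegrable_sub_inv_mul hu hz) ((Polynomial.X - Polynomial.C z) * p) =
      circleFunctional u hu p := by
  rw [circleFunctional_apply, circleFunctional_apply]
  congr 1
  refine circleIntegral.integral_congr zero_le_one fun ζ hζ => ?_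
  have : ζ - z ≠ 0 := sub_ne_zero.2 (ne_of_mem_of_not_mem hζ hz)
  simp only [eval_mul, eval_sub, eval_X, eval_C]
  field_simp

/-- Cauchy transforms are continuous off the circle. -/
lemma continuousAt_cauchy {u : ℂ → ℂ} (hu : CircleIntegrable u 0 1) {z : ℂ}
    (hz : z ∉ sphere (0 : ℂ) 1) :
    ContinuousAt (fun x => ∮ ζ in C(0, 1), (ζ - x)⁻¹ * u ζ) z := by
  have hz1 : ‖z‖ ≠ 1 := by simpa using hz
  set δ := |1 - ‖z‖| with hδ
  have hδ0 : 0 < δ := abs_pos.2 (sub_ne_zero.2 hz1.symm)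
  have hdist : ∀ x ∈ ball z (δ / 2), ∀ ζ : ℂ, ‖ζ‖ = 1 → δ / 2 ≤ ‖ζ - x‖ := by
    intro x hx ζ hζ
    have h1 : δ ≤ ‖ζ - z‖ := by
      have := abs_norm_sub_norm_le ζ z
      rwa [hζ] at this
    have h2 : ‖x - z‖ < δ / 2 := by simpa [dist_eq_norm] using hx
    have h3 : ‖ζ - z‖ ≤ ‖ζ - x‖ + ‖x - z‖ := norm_sub_le_norm_sub_add_norm_sub ζ x z
    linarith
  have hball : ball z (δ / 2) ∈ 𝓝 z := ball_mem_nhds z (by positivity)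
  have hns : ∀ x ∈ ball z (δ / 2), x ∉ sphere (0 : ℂ) 1 := by
    intro x hx hxs
    have := hdist x hx x (by simpa using hxs)
    simp at this
    linarith
  have hnorm : ∀ θ : ℝ, ‖circleMap 0 1 θ‖ = 1 := fun θ => by simp
  unfold circleIntegral
  refine intervalIntegral.continuousAt_of_dominated_interval
    (bound := fun θ => (δ / 2)⁻¹ * ‖u (circleMap 0 1 θ)‖) ?_ ?_ ?_ ?_
  · filter_upwards [hball] with x hx
    exact (circleIntegrable_sub_inv_mul hu (hns x hx)).out.def'.aestronglyMeasurable
  · filter_upwards [hball] with x hx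
    refine Eventually.of_forall fun θ _ => ?_
    rw [deriv_circleMap, norm_smul, norm_mul, norm_mul, norm_inv, hnorm]
    simp only [Complex.norm_I, mul_one, one_mul]
    gcongr
    exact hdist x hx _ (hnorm θ)
  · exact (IntervalIntegrable.norm hu).const_mul _
  · refine Eventually.of_forall fun θ _ => ?_
    have hne : circleMap 0 1 θ - z ≠ 0 := by
      refine sub_ne_zero.2 fun h => hz ?_
      rw [← h]; simp
    fun_prop (disch := assumption)

/-- Plemelj applied to `z^j g(z) - c`, which vanishes at infinity. At `z = 0` and `j = i + 1` it
reads off the `i`-th moment of the jump from the behaviour at infinity. -/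
lemma cauchy_of_jump {g gp gm u : ℂ → ℂ} (hg : HasBoundaryValues g gp gm)
    (hj : ∀ ζ ∈ sphere (0 : ℂ) 1, gp ζ - gm ζ = u ζ) (j : ℕ) {c : ℂ}
    (h0 : Tendsto (fun z => z ^ j * g z) (cobounded ℂ) (𝓝 c)) {z : ℂ}
    (hz : z ∉ sphere (0 : ℂ) 1) :
    (∮ ζ in C(0, 1), (ζ - z)⁻¹ * (ζ ^ j * u ζ)) =
      2 * Real.pi * Complex.I * (z ^ j * g z - c) := by
  have h1 := ((HasBoundaryValues.of_differentiable (h := fun z : ℂ => z ^ j) (by fun_prop)).mul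
    hg).sub (HasBoundaryValues.of_differentiable (h := fun _ : ℂ => c) (by fun_prop))
  rw [← h1.eq_cauchy (by simpa using h0.sub_const c) hz]
  refine circleIntegral.integral_congr zero_le_one fun ζ hζ => ?_
  simp only [← hj ζ hζ]
  ring

lemma nhdsWithin_outer_neBot {z : ℂ} (hz : z ∈ sphere (0 : ℂ) 1) :
    (𝓝[{w : ℂ | 1 < ‖w‖}] z).NeBot := by
  rw [← mem_closure_iff_nhdsWithin_neBot, closure_setOf_lt_norm]
  simp at hz ⊢
  exact hz.ge

lemma eventually_ne_zero_cobounded : ∀ᶠ z : ℂ in cobounded ℂ, z ≠ 0 := by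
  filter_upwards [(tendsto_norm_cobounded_atTop (E := ℂ)).eventually_gt_atTop 0] with z hz
  exact norm_pos_iff.1 hz

variable {n : ℕ} {f : ℂ → ℂ} {Y : ℂ → Matrix (Fin 2) (Fin 2) ℂ}

/-- The argument needs only that the error tends to zero, not its rate. -/
lemma IsRHSolution.exists_error (hY : IsRHSolution n f Y) :
    ∃ E : ℂ → Matrix (Fin 2) (Fin 2) ℂ,
      (∀ i j, Tendsto (fun z => E z i j) (cobounded ℂ) (𝓝 0)) ∧
      ∀ᶠ z in cobounded ℂ, z ≠ 0 ∧ Y z 0 0 = (1 + E z 0 0) * z ^ n ∧ Y z 1 0 = E z 1 0 * z ^ n ∧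
        Y z 0 1 = E z 0 1 * (z ^ n)⁻¹ ∧ Y z 1 1 = (1 + E z 1 1) * (z ^ n)⁻¹ := by
  obtain ⟨E, hE, hYE⟩ := hY.atInfinity
  have hinv : Tendsto (fun z : ℂ => 1 / z) (cobounded ℂ) (𝓝 0) := by
    simpa using tendsto_inv₀_cobounded (α := ℂ)
  refine ⟨E, fun i j => (hE i j).trans_tendsto hinv, ?_⟩
  filter_upwards [hYE, eventually_ne_zero_cobounded] with z hz hz0
  refine ⟨hz0, ?_, ?_, ?_, ?_⟩ <;> rw [hz] <;> simp [Matrix.mul_apply, Fin.sum_univ_two]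

/-- The boundary values of a Riemann–Hilbert solution, entrywise. -/
lemma IsRHSolution.exists_boundary (hY : IsRHSolution n f Y) :
    ∃ Ym : ℂ → Matrix (Fin 2) (Fin 2) ℂ,
      (∀ i, HasBoundaryValues (fun z => Y z i 0) (fun z => Ym z i 0) (fun z => Ym z i 0)) ∧
      ∀ i, HasBoundaryValues (fun z => Y z i 1)
        (fun z => z ^ (-(n : ℤ)) * f z * Ym z i 0 + Ym z i 1) (fun z => Ym z i 1) := by
  obtain ⟨Yp, Ym, h⟩ := hY.jump
  have hent : ∀ i j, HasBoundaryValues (fun z => Y z i j) (fun z => Yp z i j)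
      (fun z => Ym z i j) := fun i j =>
    ⟨hY.analytic i j, fun z hz => ((h z hz).1.apply_nhds i).apply_nhds j,
      fun z hz => ((h z hz).2.1.apply_nhds i).apply_nhds j⟩
  refine ⟨Ym, fun i => (hent i 0).congr ?_ fun _ _ => rfl,
    fun i => (hent i 1).congr ?_ fun _ _ => rfl⟩ <;>
  · intro z hz
    rw [(h z hz).2.2]
    simp [Matrix.mul_apply, Fin.sum_univ_two]
    try ring

/-- The jump matrix has determinant one, so `det Y - 1` has no jump; it also vanishes at infinity
because the powers `z^{±n}` cancel. -/
lemma IsRHSolution.det_eq_one (hY : IsRHSolution n f Y) {z : ℂ} (hz : z ∉ sphere (0 : ℂ) 1) :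
    (Y z).det = 1 := by
  obtain ⟨Ym, h0, h1⟩ := hY.exists_boundary
  obtain ⟨E, hE, hYE⟩ := hY.exists_error
  have hb := (((h0 0).mul (h1 1)).sub ((h1 0).mul (h0 1))).sub
    (HasBoundaryValues.of_differentiable (h := fun _ : ℂ => (1 : ℂ)) (by fun_prop))
  have hb' := hb.congr (hp := fun z => Ym z 0 0 * Ym z 1 1 - Ym z 0 1 * Ym z 1 0 - 1)
    (fun z _ => by ring) fun _ _ => rfl
  have hlim : Tendsto (fun z => Y z 0 0 * Y z 1 1 - Y z 0 1 * Y z 1 0 - 1) (cobounded ℂ)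
      (𝓝 0) := by
    have h2 : Tendsto (fun z => (1 + E z 0 0) * (1 + E z 1 1) - E z 0 1 * E z 1 0 - 1)
        (cobounded ℂ) (𝓝 ((1 + 0) * (1 + 0) - 0 * 0 - 1)) :=
      (((tendsto_const_nhds.add (hE 0 0)).mul (tendsto_const_nhds.add (hE 1 1))).sub
        ((hE 0 1).mul (hE 1 0))).sub_const 1
    simp only [add_zero, mul_one, mul_zero, sub_zero, sub_self] at h2
    refine h2.congr' ?_
    filter_upwards [hYE] with z hz
    obtain ⟨hz0, e1, e2, e3, e4⟩ := hz
    rw [e1, e2, e3, e4]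
    field_simp
  have := hb'.eq_zero hlim hz
  rw [Matrix.det_fin_two]
  exact sub_eq_zero.1 this

/-- The structure of a Riemann–Hilbert solution: the first column is polynomial and the second one
is obtained from it by a Cauchy transform. -/
lemma IsRHSolution.exists_polynomials (hY : IsRHSolution n f Y)
    (hw : CircleIntegrable (fun z => z ^ (-(n : ℤ)) * f z) 0 1) :
    ∃ P Q : ℂ[X], IsOrthogonalPair (circleFunctional _ hw) n P Q ∧
      (∀ z ∉ sphere (0 : ℂ) 1, Y z 0 0 = P.eval z ∧ Y z 1 0 = Q.eval z) ∧
      ∃ c : ℂ, (n ≠ 0 → c = 0) ∧ ∀ z ∉ sphere (0 : ℂ) 1,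
        (∮ ζ in C(0, 1), (ζ - z)⁻¹ * (ζ ^ (-(n : ℤ)) * f ζ * P.eval ζ)) =
          2 * Real.pi * Complex.I * Y z 0 1 ∧
        (∮ ζ in C(0, 1), (ζ - z)⁻¹ * (ζ ^ (-(n : ℤ)) * f ζ * Q.eval ζ)) =
          2 * Real.pi * Complex.I * (Y z 1 1 - c) := by
  obtain ⟨Ym, h0, h1⟩ := hY.exists_boundary
  obtain ⟨E, hE, hYE⟩ := hY.exists_error
  have hP : ∃ P : ℂ[X], (P - Polynomial.X ^ n).degree < (n : WithBot ℕ) ∧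
      ∀ z ∉ sphere (0 : ℂ) 1, Y z 0 0 = P.eval z := by
    have hb := (h0 0).sub
      (HasBoundaryValues.of_differentiable (h := fun z : ℂ => z ^ n) (by fun_prop))
    have ho : (fun z => Y z 0 0 - z ^ n) =o[cobounded ℂ] fun z => z ^ n := by
      have h2 : (fun z => E z 0 0 * z ^ n) =o[cobounded ℂ] fun z => 1 * z ^ n :=
        ((isLittleO_one_iff ℂ).2 (hE 0 0)).mul_isBigO (isBigO_refl _ _)
      simp only [one_mul] at h2
      refine h2.congr' ?_ EventuallyEq.rfl
      filter_upwards [hYE] with z hz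
      rw [hz.2.1]
      ring
    obtain ⟨p, hp, hpe⟩ := hb.exists_polynomial n ho
    refine ⟨p + Polynomial.X ^ n, by simpa using hp, fun z hz => ?_⟩
    rw [eval_add, eval_pow, eval_X, ← hpe z hz]
    ring
  have hQ : ∃ Q : ℂ[X], Q.degree < n ∧ ∀ z ∉ sphere (0 : ℂ) 1, Y z 1 0 = Q.eval z := by
    refine (h0 1).exists_polynomial n ?_
    have h2 : (fun z => E z 1 0 * z ^ n) =o[cobounded ℂ] fun z => 1 * z ^ n :=
      ((isLittleO_one_iff ℂ).2 (hE 1 0)).mul_isBigO (isBigO_refl _ _)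
    simp only [one_mul] at h2
    refine h2.congr' ?_ EventuallyEq.rfl
    filter_upwards [hYE] with z hz
    rw [hz.2.2.1]
  obtain ⟨P, hPd, hPe⟩ := hP
  obtain ⟨Q, hQd, hQe⟩ := hQ
  -- The first column extends across the circle as a polynomial, so the jump of the second column is
  -- `w p`.
  have hbd : ∀ i, ∀ p : ℂ[X], (∀ z ∉ sphere (0 : ℂ) 1, Y z i 0 = p.eval z) →
      ∀ ζ ∈ sphere (0 : ℂ) 1, ζ ^ (-(n : ℤ)) * f ζ * Ym ζ i 0 + Ym ζ i 1 - Ym ζ i 1 =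
        ζ ^ (-(n : ℤ)) * f ζ * p.eval ζ := by
    intro i p hp ζ hζ
    have := nhdsWithin_outer_neBot hζ
    have h3 : Tendsto (fun z => Y z i 0) (𝓝[{w : ℂ | 1 < ‖w‖}] ζ) (𝓝 (p.eval ζ)) := by
      refine (p.continuous.continuousAt.tendsto.mono_left nhdsWithin_le_nhds).congr' ?_
      filter_upwards [self_mem_nhdsWithin] with x hx
      rw [hp x]
      have hx' : 1 < ‖x‖ := hx
      simpa using hx'.ne'
    rw [tendsto_nhds_unique ((h0 i).outer ζ hζ) h3, add_sub_cancel_right]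
  have hdecay : ∀ (m : ℕ) (k : Fin 2), Tendsto (fun z => E z k 1 * (z ^ m)⁻¹)
      (cobounded ℂ) (𝓝 0) := by
    intro m k
    have hi : Tendsto (fun z : ℂ => (z⁻¹) ^ m) (cobounded ℂ) (𝓝 (0 ^ m)) :=
      (tendsto_inv₀_cobounded (α := ℂ)).pow m
    simpa using (hE k 1).mul hi
  have hinvm : ∀ m : ℕ, m ≠ 0 → Tendsto (fun z : ℂ => (z ^ m)⁻¹) (cobounded ℂ) (𝓝 0) := by
    intro m hm
    have hi : Tendsto (fun z : ℂ => (z⁻¹) ^ m) (cobounded ℂ) (𝓝 (0 ^ m)) :=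
      (tendsto_inv₀_cobounded (α := ℂ)).pow m
    simpa [hm] using hi
  have hlim0 : ∀ j ≤ n, Tendsto (fun z => z ^ j * Y z 0 1) (cobounded ℂ) (𝓝 0) := by
    intro j hj
    obtain ⟨m, rfl⟩ := Nat.exists_eq_add_of_le hj
    refine (hdecay m 0).congr' ?_
    filter_upwards [hYE] with z hz
    have hz0 := hz.1
    rw [hz.2.2.2.1, pow_add]
    field_simp
  -- The limit `1` at `j = n` produces the normalisation `Λ(Q X^{n-1}) = -1`. When `n = 0` it occurs
  -- already at `j = 0`, which is the source of the constant `c`.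
  have hlim1 : ∀ j m, j + m = n →
      Tendsto (fun z => z ^ j * Y z 1 1) (cobounded ℂ) (𝓝 (if m = 0 then 1 else 0)) := by
    rintro j m rfl
    have e : ∀ᶠ z in cobounded ℂ, (z ^ m)⁻¹ + E z 1 1 * (z ^ m)⁻¹ = z ^ j * Y z 1 1 := by
      filter_upwards [hYE] with z hz
      have hz0 := hz.1
      rw [hz.2.2.2.2, pow_add]
      field_simp
    refine Tendsto.congr' e ?_
    have h4 := hdecay m 1
    split_ifs with hm
    · subst hm
      simpa using h4.const_add 1
    · simpa using (hinvm m hm).add h4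
  have h0s : (0 : ℂ) ∉ sphere (0 : ℂ) 1 := by simp
  have hmom : ∀ (p : ℂ[X]) (i : ℕ),
      (∮ ζ in C(0, 1), (ζ - 0)⁻¹ * (ζ ^ (i + 1) * (ζ ^ (-(n : ℤ)) * f ζ * p.eval ζ))) =
      ∮ ζ in C(0, 1), ζ ^ (-(n : ℤ)) * f ζ * (p * Polynomial.X ^ i).eval ζ := by
    intro p i
    refine circleIntegral.integral_congr zero_le_one fun ζ hζ => ?_
    have hζ0 : ζ ≠ 0 := by rintro rfl; simp at hζ
    simp only [eval_mul, eval_pow, eval_X, sub_zero, pow_succ]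
    field_simp
  have hpi : (2 * Real.pi * Complex.I : ℂ) ≠ 0 := Complex.two_pi_I_ne_zero
  have hΛP : ∀ i < n, circleFunctional _ hw (P * Polynomial.X ^ i) = 0 := by
    intro i hi
    rw [circleFunctional_apply, ← hmom, cauchy_of_jump (h1 0) (hbd 0 P hPe) (i + 1)
      (hlim0 (i + 1) hi) h0s]
    simp
  have hΛQ : ∀ i m, i + 1 + m = n → circleFunctional _ hw (Q * Polynomial.X ^ i) =
      if m = 0 then -1 else 0 := by
    intro i m hi
    rw [circleFunctional_apply, ← hmom, cauchy_of_jump (h1 1) (hbd 1 Q hQe) (i + 1)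
      (hlim1 (i + 1) m hi) h0s]
    split_ifs <;> field_simp <;> simp
  refine ⟨P, Q, ⟨hPd, hQd, hΛP, fun i hi => ?_, fun i hi => ?_⟩,
    fun z hz => ⟨hPe z hz, hQe z hz⟩, if n = 0 then 1 else 0, fun h => if_neg h,
    fun z hz => ⟨?_, ?_⟩⟩
  · rw [hΛQ i (n - (i + 1)) (by omega), if_neg (by omega)]
  · rw [hΛQ i 0 (by omega), if_pos rfl]
  · have := cauchy_of_jump (h1 0) (hbd 0 P hPe) 0 (hlim0 0 n.zero_le) hz
    simpa using this
  · have := cauchy_of_jump (h1 1) (hbd 1 Q hQe) 0 (hlim1 0 n (zero_add n)) hz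
    simpa using this

/-- The entry `(Y⁻¹ Y')₂₂` as a contraction of the inverse moment matrix with Cauchy transforms. -/
theorem IsRHSolution.inv_mul_deriv (hY : IsRHSolution n f Y)
    (hw : CircleIntegrable (fun z => z ^ (-(n : ℤ)) * f z) 0 1) :
    (hankel (circleFunctional _ hw) n).det ≠ 0 ∧ ∀ z (hz : z ∉ sphere (0 : ℂ) 1),
      ((Y z)⁻¹ * matrixDeriv Y z) 1 1 = ∑ i : Fin n, ∑ j : Fin n,
        (hankel (circleFunctional _ hw) n)⁻¹ j i *
          circleFunctional _ (circleIntegrable_sub_inv_mul hw hz)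
            (Polynomial.X ^ ((i : ℕ) + (j : ℕ))) := by
  obtain ⟨P, Q, horth, hPQ, c, hc, hcau⟩ := hY.exists_polynomials hw
  refine ⟨horth.det_hankel_ne_zero, fun z hz => ?_⟩
  have hpi : (2 * Real.pi * Complex.I : ℂ) ≠ 0 := Complex.two_pi_I_ne_zero
  set w : ℂ → ℂ := fun z => z ^ (-(n : ℤ)) * f z with hw_def
  obtain ⟨k, hk⟩ : (Polynomial.X - Polynomial.C z) ∣
      (Polynomial.C (P.eval z) * Q - Polynomial.C (Q.eval z) * P) := by
    rw [dvd_iff_isRoot]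
    simp [IsRoot, mul_comm]
  have hwk : CircleIntegrable (fun ζ => w ζ * k.eval ζ) 0 1 :=
    hw.mul_continuousOn k.continuous.continuousOn
  set Λ := circleFunctional w hw
  set G : ℂ → ℂ := fun x => (2 * Real.pi * Complex.I)⁻¹ *
    ∮ ζ in C(0, 1), (ζ - x)⁻¹ * (w ζ * k.eval ζ) with hG
  set F : ℂ → ℂ := fun x => P.eval z * Y x 1 1 - Q.eval z * Y x 0 1 with hF
  -- Under the integral, `(ζ - z)/(ζ - x) = 1 + (x - z)/(ζ - x)`.
  have hFG : ∀ x ∉ sphere (0 : ℂ) 1, F x = P.eval z * c + Λ k + (x - z) * G x := by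
    intro x hx
    have hint : ∀ p : ℂ[X], CircleIntegrable (fun ζ => (ζ - x)⁻¹ * (w ζ * p.eval ζ)) 0 1 :=
      fun p => circleIntegrable_sub_inv_mul (hw.mul_continuousOn p.continuous.continuousOn) hx
    obtain ⟨e1, e2⟩ := hcau x hx
    have e3 : (∮ ζ in C(0, 1), w ζ * k.eval ζ) +
        (x - z) * (∮ ζ in C(0, 1), (ζ - x)⁻¹ * (w ζ * k.eval ζ)) =
        P.eval z * (∮ ζ in C(0, 1), (ζ - x)⁻¹ * (w ζ * Q.eval ζ)) -
        Q.eval z * (∮ ζ in C(0, 1), (ζ - x)⁻¹ * (w ζ * P.eval ζ)) := by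
      have i1 : CircleIntegrable (fun ζ => (x - z) * ((ζ - x)⁻¹ * (w ζ * k.eval ζ))) 0 1 :=
        (hint k).const_smul
      have i2 : CircleIntegrable (fun ζ => P.eval z * ((ζ - x)⁻¹ * (w ζ * Q.eval ζ))) 0 1 :=
        (hint Q).const_smul
      have i3 : CircleIntegrable (fun ζ => Q.eval z * ((ζ - x)⁻¹ * (w ζ * P.eval ζ))) 0 1 :=
        (hint P).const_smul
      simp only [← circleIntegral.integral_const_mul]
      rw [← circleIntegral.integral_add hwk i1, ← circleIntegral.integral_sub i2 i3]
      refine circleIntegral.integral_congr zero_le_one fun ζ hζ => ?_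
      have hne : ζ - x ≠ 0 := sub_ne_zero.2 (ne_of_mem_of_not_mem hζ hx)
      have hev := congrArg (Polynomial.eval ζ) hk
      simp only [eval_sub, eval_mul, eval_C, eval_X] at hev
      have hev' : (ζ - x)⁻¹ * w ζ * (P.eval z * Q.eval ζ - Q.eval z * P.eval ζ) =
        (ζ - x)⁻¹ * w ζ * ((ζ - z) * k.eval ζ) := by rw [hev]
      have hsplit : w ζ * k.eval ζ = (ζ - x)⁻¹ * (ζ - x) * (w ζ * k.eval ζ) := by
        rw [inv_mul_cancel₀ hne, one_mul]
      linear_combination hsplit - hev'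
    rw [show Λ k = (2 * Real.pi * Complex.I)⁻¹ * ∮ ζ in C(0, 1), w ζ * k.eval ζ from rfl]
    simp only [hF, hG]
    have e1' : Y x 0 1 = (2 * Real.pi * Complex.I)⁻¹ *
        ∮ ζ in C(0, 1), (ζ - x)⁻¹ * (w ζ * P.eval ζ) := by
      rw [e1, inv_mul_cancel_left₀ hpi]
    have e2' : Y x 1 1 = c + (2 * Real.pi * Complex.I)⁻¹ *
        ∮ ζ in C(0, 1), (ζ - x)⁻¹ * (w ζ * Q.eval ζ) := by
      rw [e2, inv_mul_cancel_left₀ hpi]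
      ring
    rw [e1', e2']
    linear_combination (-(2 * Real.pi * Complex.I : ℂ)⁻¹) * e3
  have hdet := hY.det_eq_one hz
  have hFz : F z = 1 := by
    rw [← hdet, Matrix.det_fin_two, (hPQ z hz).1, (hPQ z hz).2]
    simp only [hF]
    ring
  -- Setting `x = z` leaves `F z = det Y(z) = 1`, which normalises `k`. For `n = 0` the reproducing
  -- property concerns only `q = 0`.
  have hΛk : n ≠ 0 → Λ k = 1 := by
    intro hn
    have := hFG z hz
    rw [hFz, hc hn] at this
    simpa using this.symm
  have hkd := horth.degree_quotient_lt hk.symm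
  have hrep : ∀ q : ℂ[X], q.degree < n → Λ (k * q) = q.eval z := by
    intro q hq
    by_cases hn : n = 0
    · subst hn
      simp at hq
      simp [hq]
    · exact horth.reproducing hk.symm (hΛk hn) hq
  rw [sum_inv_hankel_mul horth.det_hankel_ne_zero hkd hrep
    (circleFunctional_X_sub_C_mul hw hz)]
  have hGk : circleFunctional _ (circleIntegrable_sub_inv_mul hw hz) k = G z := by
    rw [circleFunctional_apply]
    simp only [hG, mul_assoc]
  rw [hGk]
  have hnhds : (sphere (0 : ℂ) 1)ᶜ ∈ 𝓝 z := isOpen_compl_unitSphere.mem_nhds hz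
  -- The difference quotient of `F` at `z` is exactly `G`, so continuity of the Cauchy transform
  -- suffices.
  have hF' : HasDerivAt F (G z) z := by
    rw [hasDerivAt_iff_tendsto_slope]
    have hGc : ContinuousAt G z := (continuousAt_cauchy hwk hz).const_mul _
    refine (hGc.tendsto.mono_left nhdsWithin_le_nhds).congr' ?_
    filter_upwards [self_mem_nhdsWithin, mem_nhdsWithin_of_mem_nhds hnhds] with x hx hxs
    have hne : x - z ≠ 0 := sub_ne_zero.2 hx
    rw [slope_def_field, hFG x hxs, hFG z hz]
    field_simp
    ring
  have hd : ∀ i j, HasDerivAt (fun x => Y x i j) (deriv (fun x => Y x i j) z) z := fun i j =>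
    ((hY.analytic i j z hz).differentiableAt hnhds).hasDerivAt
  have hF'' := ((hd 1 1).const_mul (P.eval z)).sub ((hd 0 1).const_mul (Q.eval z))
  rw [hF'.unique hF'', ← (hPQ z hz).1, ← (hPQ z hz).2, Matrix.inv_def, hdet]
  simp [Matrix.adjugate_fin_two, Matrix.mul_apply, Fin.sum_univ_two, matrixDeriv]
  ring

end ToeplitzRH

end

/-! ### Differentiating determinants and logarithms -/

noncomputable section

namespace ToeplitzRH

open Metric Bornology MeasureTheory

/-- **Jacobi's formula**. -/
lemma hasDerivAt_det {n : ℕ} {M : ℝ → Matrix (Fin n) (Fin n) ℂ} {M' : Matrix (Fin n) (Fin n) ℂ}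
    {t : ℝ} (h : ∀ i j, HasDerivAt (fun s => M s i j) (M' i j) t) :
    HasDerivAt (fun s => (M s).det) (∑ i, ∑ j, (M t).adjugate i j * M' j i) t := by
  have h1 : HasDerivAt (fun s => (M s).det) (∑ σ : Equiv.Perm (Fin n),
      ((Equiv.Perm.sign σ : ℤ) : ℂ) *
        ∑ i, (∏ j ∈ Finset.univ.erase i, M t (σ j) j) • M' (σ i) i) t := by
    simp only [Matrix.det_apply']
    exact HasDerivAt.fun_sum fun σ _ =>
      (HasDerivAt.fun_finsetProd fun i _ => h (σ i) i).const_mul _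
  convert h1 using 1
  simp only [Finset.mul_sum]
  conv_rhs => rw [Finset.sum_comm]
  refine Finset.sum_congr rfl fun i _ => ?_
  -- By Cramer's rule, row `i` of the adjugate computes the determinant with column `i`
  -- differentiated.
  have h2 : ∑ j, (M t).adjugate i j * M' j i = ((M t).updateCol i fun j => M' j i).det := by
    rw [← Matrix.cramer_apply, Matrix.cramer_eq_adjugate_mulVec]
    rfl
  rw [h2, Matrix.det_apply']
  refine Finset.sum_congr rfl fun σ _ => ?_
  rw [← Finset.mul_prod_erase _ _ (Finset.mem_univ i), Matrix.updateCol_self, smul_eq_mul]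
  rw [Finset.prod_congr rfl fun j hj => Matrix.updateCol_ne (Finset.ne_of_mem_erase hj)]
  ring

/-- By continuity `Im (L s - L t)` stays in `(-π, π)` near `t`, so `L` coincides there with `L t`
plus the principal logarithm of `g s / g t`. -/
lemma hasDerivAt_of_isLogBranchAt {L g : ℝ → ℂ} {t : ℝ} {S : ℂ} (hL : IsLogBranchAt L g t)
    (hg : HasDerivAt g (g t * S) t) (hg0 : g t ≠ 0) : HasDerivAt L S t := by
  have hL' : ∀ᶠ s in 𝓝 t, ContinuousAt L s ∧ Complex.exp (L s) = g s := hL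
  have hc := hL'.self_of_nhds.1
  have h1 : HasDerivAt (fun s => Complex.log (g s / g t) + L t) S t := by
    have h2 : HasDerivAt (fun s => g s / g t) S t := by
      have := hg.div_const (g t)
      rwa [mul_div_cancel_left₀ _ hg0] at this
    have h3 := h2.clog_real (by rw [div_self hg0]; exact Complex.one_mem_slitPlane)
    rw [div_self hg0, div_one] at h3
    exact h3.add_const _
  refine h1.congr_of_eventuallyEq ?_
  have him : ∀ᶠ s in 𝓝 t, (L s - L t).im ∈ Set.Ioo (-Real.pi) Real.pi := by
    have : ContinuousAt (fun s => (L s - L t).im) t :=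
      Complex.continuous_im.continuousAt.comp (hc.sub continuousAt_const)
    refine this.eventually_mem (isOpen_Ioo.mem_nhds ?_)
    simp [Real.pi_pos]
  filter_upwards [hL', him] with s hs hsi
  rw [← hs.2, ← hL'.self_of_nhds.2, ← Complex.exp_sub, Complex.log_exp hsi.1 hsi.2.le]
  ring

lemma exists_isLogBranchAt {g : ℝ → ℂ} {t : ℝ} (hg : ∀ᶠ s in 𝓝 t, ContinuousAt g s)
    (hg0 : g t ≠ 0) : ∃ L : ℝ → ℂ, IsLogBranchAt L g t := by
  refine ⟨fun s => Complex.log (g s / g t) + Complex.log (g t), ?_⟩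
  have hslit : ∀ᶠ s in 𝓝 t, g s / g t ∈ Complex.slitPlane := by
    refine (hg.self_of_nhds.div_const (g t)).eventually_mem (Complex.isOpen_slitPlane.mem_nhds ?_)
    rw [div_self hg0]
    exact Complex.one_mem_slitPlane
  filter_upwards [hslit, hg] with s hs hc
  refine ⟨((hc.div_const (g t)).clog hs).add continuousAt_const, ?_⟩
  rw [Complex.exp_add, Complex.exp_log (Complex.slitPlane_ne_zero hs), Complex.exp_log hg0,
    div_mul_cancel₀ _ hg0]

/-! ### The symbol and its derivative in `t` -/

/-- The branch cut along the positive half-axis is the principal one rotated by `π`. -/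
lemma logZeroTwoPi_eq {w : ℂ} (hw : -w ∈ Complex.slitPlane) :
    logZeroTwoPi w = Complex.log (-w) + Real.pi * Complex.I := by
  have harg : argZeroTwoPi w = (-w).arg + Real.pi := by
    unfold argZeroTwoPi
    rcases lt_trichotomy w.im 0 with h | h | h
    · rw [if_neg (by rw [Complex.arg_nonneg_iff]; linarith),
        Complex.arg_neg_eq_arg_add_pi_of_im_neg h]
      ring
    · have hre : w.re < 0 := by
        rcases hw with h1 | h1
        · simpa using h1
        · simp [h] at h1
      have e1 : w.arg = Real.pi := Complex.arg_eq_pi_iff.2 ⟨hre, h⟩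
      have e2 : (-w).arg = 0 := Complex.arg_eq_zero_iff.2 ⟨by simpa using hre.le, by simpa using h⟩
      rw [e1, e2, if_pos Real.pi_pos.le]
      ring
    · rw [if_pos (Complex.arg_nonneg_iff.2 h.le), Complex.arg_neg_eq_arg_sub_pi_of_im_pos h]
      ring
  rw [logZeroTwoPi, harg, Complex.log, norm_neg]
  push_cast
  ring

lemma hasDerivAt_powZeroTwoPi {c : ℝ → ℂ} {c' a : ℂ} {s : ℝ} (h : HasDerivAt c c' s)
    (hs : -c s ∈ Complex.slitPlane) :
    HasDerivAt (fun x => powZeroTwoPi (c x) a) (powZeroTwoPi (c s) a * (a * (c' / c s))) s := by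
  have h1 : HasDerivAt (fun x => logZeroTwoPi (c x)) (c' / c s) s := by
    have h2 := (h.neg.clog_real hs).add_const (Real.pi * Complex.I : ℂ)
    rw [Pi.neg_apply, neg_div_neg_eq] at h2
    refine h2.congr_of_eventuallyEq ?_
    filter_upwards [h.neg.continuousAt.eventually_mem (Complex.isOpen_slitPlane.mem_nhds hs)]
      with x hx
    exact logZeroTwoPi_eq hx
  exact (h1.const_mul a).cexp

/-- The logarithmic derivative of the symbol in `t`. -/
def symbolLogDeriv (α β : ℂ) (t : ℝ) (z : ℂ) : ℂ :=
  -(α + β) * (Real.exp t : ℂ) * (z - (Real.exp t : ℂ))⁻¹ +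
    (α - β) * (Real.exp (-t) : ℂ) * (z - (Real.exp (-t) : ℂ))⁻¹

/-- On the circle `z - e^s` never meets the cut, while `z - e^{-s}` meets it only at `z = 1`. The
factor `z^{-α+β}` does not depend on `s`, so its own cut is harmless. -/
lemma hasDerivAt_symbol (α β : ℂ) (V : ℂ → ℂ) {s : ℝ} (hs : 0 < s) {z : ℂ} (hz : ‖z‖ = 1)
    (hz1 : z ≠ 1) :
    HasDerivAt (fun x => symbol α β V x z) (symbol α β V s z * symbolLogDeriv α β s z) s := by
  have hsq : z.re ^ 2 + z.im ^ 2 = 1 := by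
    have := Complex.sq_norm z
    rw [hz, Complex.normSq_apply] at this
    nlinarith
  have hre : z.re ≤ 1 := (Complex.re_le_norm z).trans hz.le
  have hexp : 1 < Real.exp s := Real.one_lt_exp_iff.2 hs
  have h1 : HasDerivAt (fun x : ℝ => z - (Real.exp x : ℂ)) (-(Real.exp s : ℂ)) s :=
    ((Real.hasDerivAt_exp s).ofReal_comp).const_sub z
  have h2 : HasDerivAt (fun x : ℝ => z - (Real.exp (-x) : ℂ)) (Real.exp (-s) : ℂ) s := by
    have h3 : HasDerivAt (fun x : ℝ => Real.exp (-x)) (Real.exp (-s) * -1) s :=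
      (hasDerivAt_neg s).exp
    simpa using (h3.ofReal_comp).const_sub z
  have m1 : -(z - (Real.exp s : ℂ)) ∈ Complex.slitPlane := by
    left
    simp only [neg_sub, Complex.sub_re, Complex.ofReal_re]
    linarith
  have m2 : -(z - (Real.exp (-s) : ℂ)) ∈ Complex.slitPlane := by
    rw [Complex.mem_slitPlane_iff]
    by_cases him : z.im = 0
    · left
      have hre1 : z.re ≠ 1 := fun h => hz1 (Complex.ext (by simpa using h) (by simpa using him))
      have : (z.re - 1) * (z.re + 1) = 0 := by rw [him] at hsq; linarith
      have hre' : z.re = -1 := by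
        rcases mul_eq_zero.1 this with h | h
        · exact absurd (by linarith) hre1
        · linarith
      simp only [neg_sub, Complex.sub_re, Complex.ofReal_re, hre']
      have := Real.exp_pos (-s)
      linarith
    · right
      rw [neg_sub, Complex.sub_im, Complex.ofReal_im, zero_sub]
      exact neg_ne_zero.2 him
  have h3 := ((((hasDerivAt_powZeroTwoPi (a := α + β) h1 m1).mul
    (hasDerivAt_powZeroTwoPi (a := α - β) h2 m2)).mul_const (powZeroTwoPi z (-α + β))).mul_const
    (Complex.exp (-(Complex.I * (Real.pi : ℂ) * (α + β))))).mul_const (Complex.exp (V z))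
  refine h3.congr_deriv ?_
  simp only [symbol, symbolLogDeriv, div_eq_mul_inv]
  ring

lemma measurable_powZeroTwoPi (a : ℂ) : Measurable fun z => powZeroTwoPi z a := by
  have h1 : Measurable argZeroTwoPi :=
    Measurable.ite (measurableSet_le measurable_const Complex.measurable_arg)
      Complex.measurable_arg (Complex.measurable_arg.add_const _)
  have h2 : Measurable logZeroTwoPi := by
    unfold logZeroTwoPi
    exact (Complex.measurable_ofReal.comp (Real.measurable_log.comp measurable_norm)).add
      ((Complex.measurable_ofReal.comp h1).mul_const _)
  exact Complex.measurable_exp.comp (h2.const_mul a)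

lemma norm_powZeroTwoPi_le {m M : ℝ} (hm : 0 < m) (a : ℂ) {w : ℂ} (h1 : m ≤ ‖w‖) (h2 : ‖w‖ ≤ M) :
    ‖powZeroTwoPi w a‖ ≤ Real.exp (‖a‖ * (|Real.log m| + |Real.log M| + 2 * Real.pi)) := by
  have hlog : |Real.log ‖w‖| ≤ |Real.log m| + |Real.log M| := by
    have e1 := Real.log_le_log hm h1
    have e2 := Real.log_le_log (hm.trans_le h1) h2
    rw [abs_le]
    constructor
    · linarith [neg_abs_le (Real.log m), abs_nonneg (Real.log M)]
    · linarith [le_abs_self (Real.log M), abs_nonneg (Real.log m)]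
  have harg : |argZeroTwoPi w| ≤ 2 * Real.pi := by
    unfold argZeroTwoPi
    have e1 := Complex.neg_pi_lt_arg w
    have e2 := Complex.arg_le_pi w
    have := Real.pi_pos
    split_ifs with h
    · rw [abs_of_nonneg h]; linarith
    · rw [abs_of_nonneg (by linarith)]; linarith
  have hl : ‖logZeroTwoPi w‖ ≤ |Real.log m| + |Real.log M| + 2 * Real.pi := by
    refine (norm_add_le _ _).trans (add_le_add ?_ ?_)
    · simpa using hlog
    · simpa using harg
  refine (Complex.norm_exp_le_exp_norm _).trans (Real.exp_le_exp.2 ?_)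
  rw [norm_mul]
  gcongr

lemma norm_sub_exp_bounds {a b s : ℝ} (ha : 0 < a) (has : a ≤ s) (hsb : s ≤ b) {z : ℂ}
    (hz : ‖z‖ = 1) :
    (1 - Real.exp (-a) ≤ ‖z - (Real.exp s : ℂ)‖ ∧ ‖z - (Real.exp s : ℂ)‖ ≤ 1 + Real.exp b) ∧
    1 - Real.exp (-a) ≤ ‖z - (Real.exp (-s) : ℂ)‖ ∧
      ‖z - (Real.exp (-s) : ℂ)‖ ≤ 1 + Real.exp b := by
  have n1 : ∀ x : ℝ, ‖(Real.exp x : ℂ)‖ = Real.exp x := fun x => by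
    rw [Complex.norm_real, Real.norm_eq_abs, abs_of_pos (Real.exp_pos x)]
  have l1 := norm_sub_le z (Real.exp s : ℂ)
  have l2 := norm_sub_le z (Real.exp (-s) : ℂ)
  have l3 := norm_sub_norm_le z (Real.exp (-s) : ℂ)
  have l4 := norm_sub_norm_le (Real.exp s : ℂ) z
  rw [norm_sub_rev] at l4
  rw [n1, hz] at l1 l2 l3 l4
  have e1 : Real.exp s ≤ Real.exp b := Real.exp_le_exp.2 hsb
  have e2 : Real.exp (-s) ≤ Real.exp (-a) := Real.exp_le_exp.2 (by linarith)
  have e3 : Real.exp (-s) ≤ Real.exp b := Real.exp_le_exp.2 (by linarith)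
  -- These two inequalities give `e^s - 1 ≥ s ≥ a ≥ 1 - e^{-a}`, so one lower bound serves both
  -- singular points.
  have e4 := Real.add_one_le_exp s
  have e5 := Real.add_one_le_exp (-a)
  refine ⟨⟨?_, ?_⟩, ?_, ?_⟩ <;> linarith

/-- For `s` in `[a, b]` the points `e^{±s}` stay at bounded distance from the circle and away from
it, so every factor is bounded. The powers may be discontinuous across their cuts; boundedness and
measurability are all that domination requires. -/
lemma exists_symbol_bound (α β : ℂ) {V : ℂ → ℂ} (hV : ContinuousOn V (sphere (0 : ℂ) 1)) {a b : ℝ}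
    (ha : 0 < a) : ∃ B : ℝ, ∀ s, a ≤ s → s ≤ b → ∀ z : ℂ, ‖z‖ = 1 →
      ‖symbol α β V s z‖ ≤ B ∧ ‖symbol α β V s z * symbolLogDeriv α β s z‖ ≤ B := by
  obtain ⟨v, hv⟩ := (isCompact_sphere (0 : ℂ) 1).exists_bound_of_continuousOn hV
  have hm : 0 < 1 - Real.exp (-a) := by
    have : Real.exp (-a) < 1 := by simpa using ha
    linarith
  set m := 1 - Real.exp (-a)
  set M := 1 + Real.exp b
  set p : ℂ → ℝ := fun c => Real.exp (‖c‖ * (|Real.log m| + |Real.log M| + 2 * Real.pi))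
  set B₁ : ℝ := p (α + β) * p (α - β) *
    Real.exp (‖-α + β‖ * (|Real.log 1| + |Real.log 1| + 2 * Real.pi)) *
    ‖Complex.exp (-(Complex.I * (Real.pi : ℂ) * (α + β)))‖ * Real.exp v
  set B₂ : ℝ := ‖-(α + β)‖ * Real.exp b * m⁻¹ + ‖α - β‖ * Real.exp b * m⁻¹
  have n1 : ∀ x : ℝ, ‖(Real.exp x : ℂ)‖ = Real.exp x := fun x => by
    rw [Complex.norm_real, Real.norm_eq_abs, abs_of_pos (Real.exp_pos x)]
  have hB1 : 0 ≤ B₁ := by positivity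
  have hB2 : 0 ≤ B₂ := by positivity
  have key : ∀ s, a ≤ s → s ≤ b → ∀ z : ℂ, ‖z‖ = 1 →
      ‖symbol α β V s z‖ ≤ B₁ ∧ ‖symbolLogDeriv α β s z‖ ≤ B₂ := by
    intro s has hsb z hz
    obtain ⟨⟨b1, b2⟩, b3, b4⟩ := norm_sub_exp_bounds ha has hsb hz
    constructor
    · rw [symbol, norm_mul, norm_mul, norm_mul, norm_mul]
      have hVz : ‖Complex.exp (V z)‖ ≤ Real.exp v :=
        (Complex.norm_exp_le_exp_norm _).trans (Real.exp_le_exp.2 (hv z (by simpa using hz)))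
      have q1 : _ ≤ p (α + β) := norm_powZeroTwoPi_le hm (α + β) b1 b2
      have q2 : _ ≤ p (α - β) := norm_powZeroTwoPi_le hm (α - β) b3 b4
      have q3 := norm_powZeroTwoPi_le one_pos (-α + β) hz.ge hz.le
      simp only [B₁]
      gcongr
    · refine (norm_add_le _ _).trans ?_
      rw [norm_mul, norm_mul, norm_mul, norm_mul, norm_inv, norm_inv, n1, n1]
      have e1 : Real.exp s ≤ Real.exp b := Real.exp_le_exp.2 hsb
      have e3 : Real.exp (-s) ≤ Real.exp b := Real.exp_le_exp.2 (by linarith)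
      simp only [B₂]
      gcongr
  refine ⟨B₁ + B₁ * B₂, fun s has hsb z hz => ?_⟩
  obtain ⟨k1, k2⟩ := key s has hsb z hz
  refine ⟨by nlinarith [mul_nonneg hB1 hB2], ?_⟩
  rw [norm_mul]
  have := mul_le_mul k1 k2 (norm_nonneg _) hB1
  linarith

lemma measurable_symbol_circle (α β : ℂ) {V : ℂ → ℂ} (hV : ContinuousOn V (sphere (0 : ℂ) 1))
    (s : ℝ) : Measurable fun θ : ℝ => symbol α β V s (Complex.exp ((θ : ℂ) * Complex.I)) := by
  have he : Measurable fun θ : ℝ => Complex.exp ((θ : ℂ) * Complex.I) := by fun_prop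
  have hVc : Continuous fun θ : ℝ => V (Complex.exp ((θ : ℂ) * Complex.I)) :=
    hV.comp_continuous (by fun_prop) fun θ => by simp
  have h1 := (measurable_powZeroTwoPi (α + β)).comp (he.sub_const (Real.exp s : ℂ))
  have h2 := (measurable_powZeroTwoPi (α - β)).comp (he.sub_const (Real.exp (-s) : ℂ))
  have h3 := (measurable_powZeroTwoPi (-α + β)).comp he
  exact (((h1.mul h2).mul h3).mul_const _).mul (Complex.measurable_exp.comp hVc.measurable)

lemma measurable_symbolLogDeriv_circle (α β : ℂ) (s : ℝ) :
    Measurable fun θ : ℝ => symbolLogDeriv α β s (Complex.exp ((θ : ℂ) * Complex.I)) := by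
  have he : Measurable fun θ : ℝ => Complex.exp ((θ : ℂ) * Complex.I) := by fun_prop
  exact ((he.sub_const _).inv.const_mul _).add ((he.sub_const _).inv.const_mul _)

lemma norm_exp_neg_int_mul (k : ℤ) (θ : ℝ) :
    ‖Complex.exp (-((k : ℂ) * (θ : ℂ) * Complex.I))‖ = 1 := by
  have : -((k : ℂ) * (θ : ℂ) * Complex.I) = ((-(k * θ) : ℝ) : ℂ) * Complex.I := by push_cast; ring
  rw [this, Complex.norm_exp_ofReal_mul_I]

lemma intervalIntegrable_of_measurable_of_bound {u : ℝ → ℂ} (hu : Measurable u) {B : ℝ}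
    (hB : ∀ θ, ‖u θ‖ ≤ B) (a b : ℝ) : IntervalIntegrable u volume a b :=
  (intervalIntegrable_const (c := B)).mono_fun hu.aestronglyMeasurable
    (Eventually.of_forall fun θ => (hB θ).trans (le_abs_self B))

theorem hasDerivAt_fourierCoefficient_symbol (α β : ℂ) {V : ℂ → ℂ}
    (hV : ContinuousOn V (sphere (0 : ℂ) 1)) {t : ℝ} (ht : 0 < t) (k : ℤ) :
    HasDerivAt (fun s => fourierCoefficient (symbol α β V s) k)
      (fourierCoefficient (fun z => symbol α β V t z * symbolLogDeriv α β t z) k) t := by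
  obtain ⟨B, hB⟩ := exists_symbol_bound α β hV (b := 2 * t) (half_pos ht)
  have hmk : Measurable fun θ : ℝ => Complex.exp (-((k : ℂ) * (θ : ℂ) * Complex.I)) := by fun_prop
  refine HasDerivAt.const_mul _ ?_
  refine (intervalIntegral.hasDerivAt_integral_of_dominated_loc_of_deriv_le
    (F := fun s θ => symbol α β V s (Complex.exp ((θ : ℂ) * Complex.I)) *
        Complex.exp (-((k : ℂ) * (θ : ℂ) * Complex.I)))
    (F' := fun s θ => symbol α β V s (Complex.exp ((θ : ℂ) * Complex.I)) *
        symbolLogDeriv α β s (Complex.exp ((θ : ℂ) * Complex.I)) *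
        Complex.exp (-((k : ℂ) * (θ : ℂ) * Complex.I)))
    (bound := fun _ => B) (s := Set.Ioo (t / 2) (2 * t))
    (isOpen_Ioo.mem_nhds ⟨by linarith, by linarith⟩) ?_ ?_ ?_ ?_ ?_ ?_).2
  · exact Eventually.of_forall fun s =>
      ((measurable_symbol_circle α β hV s).mul hmk).aestronglyMeasurable
  · refine intervalIntegrable_of_measurable_of_bound
      ((measurable_symbol_circle α β hV t).mul hmk) (B := B) (fun θ => ?_) _ _
    rw [Pi.mul_apply, norm_mul, norm_exp_neg_int_mul, mul_one]
    exact (hB t (by linarith) (by linarith) _ (Complex.norm_exp_ofReal_mul_I θ)).1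
  · exact (((measurable_symbol_circle α β hV t).mul
      (measurable_symbolLogDeriv_circle α β t)).mul hmk).aestronglyMeasurable
  · refine Eventually.of_forall fun θ _ s hs => ?_
    rw [norm_mul, norm_exp_neg_int_mul, mul_one]
    exact (hB s hs.1.le hs.2.le _ (Complex.norm_exp_ofReal_mul_I θ)).2
  · exact intervalIntegrable_const
  -- On `(0, 2π]` the only parameter of the exceptional point `z = 1` is `2π`, a null set.
  · have hne : ∀ᵐ θ : ℝ, θ ≠ 2 * Real.pi := by
      simp [ae_iff]
    filter_upwards [hne] with θ hθ hθ' s hs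
    rw [Set.uIoc_of_le Real.two_pi_pos.le] at hθ'
    refine (hasDerivAt_symbol α β V (by linarith [hs.1]) (Complex.norm_exp_ofReal_mul_I θ) ?_).mul_const _
    intro h
    rw [Complex.exp_eq_one_iff] at h
    obtain ⟨N, hN⟩ := h
    have h2 : (θ : ℂ) = ((N * (2 * Real.pi) : ℝ) : ℂ) := by
      apply mul_right_cancel₀ Complex.I_ne_zero
      rw [hN]; push_cast; ring
    have h3 : θ = N * (2 * Real.pi) := by exact_mod_cast h2
    have hp := Real.two_pi_pos
    have h4 : (0 : ℝ) < N := by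
      by_contra hcon
      nlinarith [hθ'.1]
    have h5 : (N : ℝ) < 2 := by
      by_contra hcon
      nlinarith [hθ'.2]
    have h6 : N = 1 := by
      have : 0 < N := by exact_mod_cast h4
      have : N < 2 := by exact_mod_cast h5
      omega
    rw [h6] at h3
    exact hθ (by simpa using h3)

/-! ### From Toeplitz to Hankel -/

lemma moment_eq_fourierCoefficient (n m : ℕ) (u : ℂ → ℂ) :
    (2 * Real.pi * Complex.I)⁻¹ * (∮ ζ in C(0, 1), ζ ^ (-(n : ℤ)) * u ζ * ζ ^ m) =
      fourierCoefficient u ((n : ℤ) - 1 - m) := by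
  rw [fourierCoefficient, circleIntegral, ← intervalIntegral.integral_const_mul,
    ← intervalIntegral.integral_const_mul]
  refine intervalIntegral.integral_congr fun θ _ => ?_
  have hc : circleMap 0 1 θ = Complex.exp ((θ : ℂ) * Complex.I) := by simp [circleMap]
  -- The lone factor `e^{iθ}` comes from `dζ = i e^{iθ} dθ` and accounts for the shift by one.
  have he : Complex.exp (-((((n : ℤ) - 1 - m : ℤ) : ℂ) * (θ : ℂ) * Complex.I)) =
      Complex.exp ((θ : ℂ) * Complex.I) * Complex.exp ((θ : ℂ) * Complex.I) ^ (-(n : ℤ)) *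
        Complex.exp ((θ : ℂ) * Complex.I) ^ m := by
    rw [← Complex.exp_int_mul, ← Complex.exp_nat_mul, ← Complex.exp_add, ← Complex.exp_add]
    congr 1
    push_cast
    ring
  simp only [deriv_circleMap, hc, he, smul_eq_mul]
  have := Complex.I_ne_zero
  have : (Real.pi : ℂ) ≠ 0 := by exact_mod_cast Real.pi_ne_zero
  field_simp

/-- The moment matrix of the weight `z⁻ⁿ f(z)`. -/
def momentMatrix (n : ℕ) (f : ℂ → ℂ) : Matrix (Fin n) (Fin n) ℂ :=
  Matrix.of fun i j => fourierCoefficient f ((n : ℤ) - 1 - ((i : ℕ) + (j : ℕ) : ℕ))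

/-- The substitution `j ↦ n - 1 - j` on rows makes the index depend on a sum. The sign does not
depend on `f`, so it drops out of logarithmic derivatives. -/
lemma toeplitzDet_eq (n : ℕ) (f : ℂ → ℂ) :
    toeplitzDet n f = ((Equiv.Perm.sign (Fin.revPerm : Equiv.Perm (Fin n)) : ℤ) : ℂ) *
      (momentMatrix n f).det := by
  rw [← Matrix.det_permute, toeplitzDet]
  congr 1
  ext j k
  simp only [Matrix.of_apply, Matrix.submatrix_apply, momentMatrix, Fin.revPerm_apply, id,
    Fin.val_rev]
  congr 1
  have := j.2
  omega

end ToeplitzRH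

end

/-! ### The differential identity -/

open ToeplitzRH Metric

theorem proposition2p1 (α β : ℂ) (hα : -(1 / 2 : ℝ) < α.re)
    (hadd : ∀ k : ℕ, α + β ≠ -((k : ℂ) + 1)) (hsub : ∀ k : ℕ, α - β ≠ -((k : ℂ) + 1))
    (V : ℂ → ℂ) (r R : ℝ) (hr : r < 1) (hR : 1 < R)
    (hV : AnalyticOnNhd ℂ V {z : ℂ | r < ‖z‖ ∧ ‖z‖ < R})
    (t : ℝ) (ht : 0 < t) (n : ℕ)
    (Y : ℂ → Matrix (Fin 2) (Fin 2) ℂ)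
    (hY : ToeplitzRH.IsRHSolution n (ToeplitzRH.symbol α β V t) Y) :
    ToeplitzRH.toeplitzDet n (ToeplitzRH.symbol α β V t) ≠ 0 ∧
    (∃ L : ℝ → ℂ, ToeplitzRH.IsLogBranchAt L
      (fun s => ToeplitzRH.toeplitzDet n (ToeplitzRH.symbol α β V s)) t) ∧
    ∀ L : ℝ → ℂ, ToeplitzRH.IsLogBranchAt L
        (fun s => ToeplitzRH.toeplitzDet n (ToeplitzRH.symbol α β V s)) t →
      HasDerivAt L
        (-(α + β) * (Real.exp t : ℂ) *
            ((Y (Real.exp t : ℂ))⁻¹ * ToeplitzRH.matrixDeriv Y (Real.exp t : ℂ)) 1 1 +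
          (α - β) * (Real.exp (-t) : ℂ) *
            ((Y (Real.exp (-t) : ℂ))⁻¹ * ToeplitzRH.matrixDeriv Y (Real.exp (-t) : ℂ)) 1 1)
        t := by
  have hVc : ContinuousOn V (sphere (0 : ℂ) 1) := hV.continuousOn.mono fun z hz => by
    have : ‖z‖ = 1 := by simpa using hz
    exact ⟨by rw [this]; exact hr, by rw [this]; exact hR⟩
  have hfi : CircleIntegrable (symbol α β V t) 0 1 := by
    obtain ⟨B, hB⟩ := exists_symbol_bound α β hVc (b := t) ht
    have := intervalIntegrable_of_measurable_of_bound (measurable_symbol_circle α β hVc t)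
      (fun θ => (hB t le_rfl le_rfl _ (Complex.norm_exp_ofReal_mul_I θ)).1) 0 (2 * Real.pi)
    simpa [CircleIntegrable, circleMap] using this
  have hw : CircleIntegrable (fun z => z ^ (-(n : ℤ)) * symbol α β V t z) 0 1 := by
    refine hfi.continuousOn_mul fun z hz => ?_
    have hz0 : z ≠ 0 := by rintro rfl; simp at hz
    exact (continuousAt_zpow₀ z _ (Or.inl hz0)).continuousWithinAt
  obtain ⟨hdet, hA⟩ := hY.inv_mul_deriv hw
  have hmom : hankel (circleFunctional _ hw) n = momentMatrix n (symbol α β V t) := by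
    ext i j
    simp only [hankel, momentMatrix, Matrix.of_apply, circleFunctional_apply,
      Polynomial.eval_pow, Polynomial.eval_X]
    exact moment_eq_fourierCoefficient n _ _
  rw [hmom] at hdet
  simp only [hmom] at hA
  have hs1 : (Real.exp t : ℂ) ∉ sphere (0 : ℂ) 1 := by
    simp [Complex.norm_exp, ht.ne']
  have hs2 : (Real.exp (-t) : ℂ) ∉ sphere (0 : ℂ) 1 := by
    simp [Complex.norm_exp, ht.ne']
  set M' := momentMatrix n (fun z => symbol α β V t z * symbolLogDeriv α β t z) with hM'
  set S := -(α + β) * (Real.exp t : ℂ) *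
            ((Y (Real.exp t : ℂ))⁻¹ * ToeplitzRH.matrixDeriv Y (Real.exp t : ℂ)) 1 1 +
          (α - β) * (Real.exp (-t) : ℂ) *
            ((Y (Real.exp (-t) : ℂ))⁻¹ * ToeplitzRH.matrixDeriv Y (Real.exp (-t) : ℂ)) 1 1 with hS
  -- The partial fractions of `symbolLogDeriv` split the differentiated moments into Cauchy-type
  -- moments at `e^t` and `e^{-t}`, the quantities contracted in `inv_mul_deriv`.
  have hM'e : ∀ i j, M' i j =
      -(α + β) * (Real.exp t : ℂ) * circleFunctional _ (circleIntegrable_sub_inv_mul hw hs1)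
        (Polynomial.X ^ ((i : ℕ) + (j : ℕ))) +
      (α - β) * (Real.exp (-t) : ℂ) * circleFunctional _ (circleIntegrable_sub_inv_mul hw hs2)
        (Polynomial.X ^ ((i : ℕ) + (j : ℕ))) := by
    intro i j
    have hi : ∀ {z : ℂ} (hz : z ∉ sphere (0 : ℂ) 1) (c : ℂ), CircleIntegrable (fun ζ =>
        c * ((ζ - z)⁻¹ * (ζ ^ (-(n : ℤ)) * symbol α β V t ζ) *
          ζ ^ ((i : ℕ) + (j : ℕ)))) 0 1 := fun hz c =>
      ((circleIntegrable_sub_inv_mul hw hz).mul_continuousOn (by fun_prop)).const_smul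
    simp only [hM', momentMatrix, Matrix.of_apply, circleFunctional_apply, Polynomial.eval_pow,
      Polynomial.eval_X]
    rw [← moment_eq_fourierCoefficient]
    rw [mul_left_comm, mul_left_comm ((α - β) * _), ← mul_add,
      ← circleIntegral.integral_const_mul (-(α + β) * _),
      ← circleIntegral.integral_const_mul ((α - β) * _),
      ← circleIntegral.integral_add (hi hs1 _) (hi hs2 _)]
    congr 2
    funext ζ
    simp only [symbolLogDeriv]
    ring
  have hD : ∀ s : ℝ, 0 < s → HasDerivAt (fun s => toeplitzDet n (symbol α β V s))
      (((Equiv.Perm.sign (Fin.revPerm : Equiv.Perm (Fin n)) : ℤ) : ℂ) *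
        ∑ i, ∑ j, (momentMatrix n (symbol α β V s)).adjugate i j *
          momentMatrix n (fun z => symbol α β V s z * symbolLogDeriv α β s z) j i) s := by
    intro s hs
    simp only [toeplitzDet_eq]
    exact (hasDerivAt_det fun i j =>
      hasDerivAt_fourierCoefficient_symbol α β hVc hs _).const_mul _
  have hD0 : toeplitzDet n (symbol α β V t) ≠ 0 := by
    rw [toeplitzDet_eq]
    refine mul_ne_zero ?_ hdet
    exact_mod_cast Units.ne_zero _
  have hDt : HasDerivAt (fun s => toeplitzDet n (symbol α β V s))
      (toeplitzDet n (symbol α β V t) * S) t := by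
    refine (hD t ht).congr_deriv ?_
    rw [toeplitzDet_eq, mul_assoc]
    congr 1
    have hadj : ∀ i j, (momentMatrix n (symbol α β V t)).adjugate i j =
        (momentMatrix n (symbol α β V t)).det * (momentMatrix n (symbol α β V t))⁻¹ i j := by
      intro i j
      rw [Matrix.inv_def, Matrix.smul_apply, Ring.inverse_eq_inv', smul_eq_mul,
        mul_inv_cancel_left₀ hdet]
    rw [hS, hA _ hs1, hA _ hs2]
    simp only [← hM', hM'e, hadj, Finset.mul_sum, ← Finset.sum_add_distrib]
    rw [Finset.sum_comm]
    exact Finset.sum_congr rfl fun i _ => Finset.sum_congr rfl fun j _ => by ring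
  refine ⟨hD0, exists_isLogBranchAt ?_ hD0, fun L hL => hasDerivAt_of_isLogBranchAt hL hDt hD0⟩
  filter_upwards [isOpen_Ioi.mem_nhds ht] with s hs
  exact (hD s hs).continuousAt
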